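/- **Setting.** Let $N\ge 1$. Alice has settings $i\in\{0,\dots,n_A-1\}$, $n_A\ge 2$, and an ancilla system $A$ with orthonormal basis $\{|i\rangle\}_i$; put $|0_X\rangle=(|0\rangle+|1\rangle)/\sqrt2$, $|1_X\rangle=(|0\rangle-|1\rangle)/\sqrt2$. Bob has measurement bases $\beta\in\{Z,X_1,\dots,X_{n_M}\}$ chosen with probabilities $p_\beta>0$, $\sum_\beta p_\beta=1$, and POVMs $\{\Gamma^{b|\beta}\}_{b\in\{0,1,\perp\}}$ on a Hilbert space $B$ (of arbitrary dimension). Let $\{\Gamma^{b|V}\}_{b\in\{0,1,\perp\}}$ be a further POVM on $B$ with $\Gamma^{\perp|V}=\Gamma^{\perp|Z}$. Put $\mathcal K=\{(i,\beta,b):\beta=Z,\ i,b\in\{0,1\}\}$ and $$S^{i,\beta,b}=p_\beta|i\rangle\langle i|\otimes\Gamma^{b|\beta},\quad V^{i,b}=p_Z|i_X\rangle\langle i_X|\otimes\Gamma^{b|V},\quad E_{\rm ph}=V^{0,1}+V^{1,0},\quad Q_l=\sum_{i,\beta,b}c^l_{i,\beta,b}|i\rangle\langle i|\otimes\Gamma^{b|\beta}\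 \ (1\le l\le n_Q),$$ where the $c^l_{i,\beta,b}$ are real and, for each $l$, take a common value $c^l_{\mathcal K}$ on $\mathcal K$. Let $W=\sum_{k}\omega_k|\omega_k\rangle\langle\omega_k|$ be an observable on $A$, with $\{|\omega_k\rangle\}_k$ an orthonormal basis of eigenvectors, and let $0<\alpha\le 1$. **Virtual estimation protocol (VEP).** The systems $A_1B_1\cdots A_NB_N$ are in an arbitrary joint density operator $\rho$ (in particular, any state obtained by a channel from a possibly correlated source). On each pair $A_uB_u$ one performs the POVM $$\{(1-\alpha)V^{i,b}\}_{i,b\in\{0,1\}}\cup\{(1-\alpha)S^{i,\beta,b}\}_{(i,\beta,b)\notin\mathcal K}\cup\{\alpha|\omega_k\rangle\langle\omega_k|\otimes 1\}_k .$$ In round $u$: $\chi^u_{\rm ph}=1$ if the outcome is $V^{0,1}$ or $V^{1,0}$, and $0$ otherwise; $\chi^u_{Q,l}=c^l_{i,\beta,b}/p_\beta$ on the outcome $S^{i,\beta,b}$, $c^l_{\mathcal K}/p_Z$ on every outcome $V^{i,b}$, and $0$ otherwise; $\chi^u_W=\omega_k$ on the outcome $|\omega_k\rangle\langle\omega_k|\otimes1$,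 and $0$ otherwise. Let $M_{\rm ph},M_{Q,l},M_W$ be the sums of these variables over $u=1,\dots,N$, and let $x^l_{\min},x^l_{\max}$ (resp. $\omega_{\min},\omega_{\max}$) be the minimum and maximum of the values of $\chi_{Q,l}$ (resp. $\chi_W$) over the outcomes listed. **Kato functions.** For $\epsilon>0$ and a real guess $g$ put $$a_{U}=\frac{3\left[72\sqrt N g(N-g)\ln\epsilon-16N^{3/2}\ln^2\epsilon+9\sqrt2N\sqrt{-(N-2g)^2\ln\epsilon\,(9g(N-g)-2N\ln\epsilon)}\right]}{4(9N-8\ln\epsilon)[9g(N-g)-2N\ln\epsilon]},$$ $$a_{L}=\frac{3\left[-72\sqrt N g(N-g)\ln\epsilon+16N^{3/2}\ln^2\epsilon+9\sqrt2N\sqrt{-(N-2g)^2\ln\epsilon\,(9g(N-g)-2N\ln\epsilon)}\right]}{4(9N-8\ln\epsilon)[9g(N-g)-2N\ln\epsilon]},$$ $$b_U(a)=\frac{\sqrt{18a^2N-(16a^2+24a\sqrt N+9N)\ln\epsilon}}{3\sqrt{2N}},\qquad b_L(a)=\frac{\sqrt{18a^2N-(16a^2-24a\sqrt N+9N)\ln\epsilon}}{3\sqrt{2N}}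 .$$ With $n[S]=(S-Nx_{\min})/(x_{\max}-x_{\min})$, define $$K^{1}_{\epsilon,N,x_{\min},x_{\max}}(S)=S+(x_{\max}-x_{\min})\left[b_U(a_U)+a_U\left(\tfrac{2n[S]}N-1\right)\right]\sqrt N,$$ $$K^{-1}_{\epsilon,N,x_{\min},x_{\max}}(S)=S-(x_{\max}-x_{\min})\left[b_L(a_L)+a_L\left(\tfrac{2n[S]}N-1\right)\right]\sqrt N$$ (both equal to $S$ if $x_{\min}=x_{\max}$), and let $\bar K^{1}$ be $K^1$ with $a_U$ replaced throughout by $\max\{-\sqrt N/2,a_U\}$; $\bar K^1$ is nondecreasing in $S$, and $\bar K^1=K^1$ when $a_U\ge-\sqrt N/2$. Each occurrence of these functions may use its own guess $g$. Finally, for a guess $g$ of the sum over $u$ of the conditional expectations of $\chi^u_{\rm ph}$ given the earlier rounds, and for $\epsilon=\epsilon_{pK}$, put $$\tilde a_U=\frac{3\sqrt N}{4}\cdot\frac{9\sqrt{(N-2g)^2N\ln\epsilon\,[N\ln\epsilon+18g(g-N)]}+4N\ln^2\epsilon+9\ln\epsilon\,[3N^2-8Ng+8g^2]}{36\ln\epsilon\,[N^2-2Ng+2g^2]+4N\ln^2\epsilon+81Ng(N-g)},\qquad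 \tilde b_U=b_L(\tilde a_U).$$ For definiteness, in all these formulas a quotient with zero denominator is read as $0$ and a square root of a negative number as $0$. **Theorem.** Let $\eta_1,\dots,\eta_{n_Q}\in\mathbb R$ satisfy $E_{\rm ph}\preceq\sum_l\eta_lQ_l+W\otimes1$, and let $M_W^U,\epsilon_{pB}\in\mathbb R$ satisfy $\Pr[M_W>M_W^U]\le\epsilon_{pB}$. Let $\epsilon_l>0$ with $\sum_l\epsilon_l=\epsilon_{pK}>0$, fix arbitrary real guesses, and suppose $\tilde a_U<\sqrt N/2$. Then, except with probability at most $3\epsilon_{pK}+\epsilon_{pB}$, $$M_{\rm ph}\le\frac{N}{\sqrt N-2\tilde a_U}\left[\frac1{\sqrt N}\left(\sum_l\eta_lK^{\operatorname{sign}(\eta_l)}_{\epsilon_l,N,x^l_{\min},x^l_{\max}}(M_{Q,l})+\frac{1-\alpha}{\alpha}\bar K^{1}_{\epsilon_{pK},N,\omega_{\min},\omega_{\max}}(M_W^U)\right)+\tilde b_U-\tilde a_U\right],$$ where $\operatorname{sign}(x)=1$ for $x\ge0$ and $-1$ for $x<0$. -/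

import Mathlib

noncomputable section

namespace QKD

/-! ### Hilbert spaces, tensor products and states

Every complex Hilbert space is, after a choice of an orthonormal basis indexed by `ι`, the space
`ℓ²(ι)`; the Hilbert tensor product of `ℓ²(ι)` and `ℓ²(R)` is `ℓ²(ι × R)`, and the `N`-fold tensor
power of `ℓ²(ι)` is `ℓ²(Fin N → ι)`. -/

/-- The Hilbert space `ℓ²(ι)` with orthonormal basis indexed by `ι`. -/
abbrev Ell (ι : Type*) := lp (fun _ : ι => ℂ) 2

/-- Bounded operators on `ℓ²(ι)`. -/
abbrev Op (ι : Type*) := Ell ι →L[ℂ] Ell ι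

/-- The basis vector `|i⟩`. -/
def ket {ι : Type*} [DecidableEq ι] (i : ι) : Ell ι := lp.single 2 i (1 : ℂ)

/-- The operator `|v⟩⟨v|`. -/
def ketbra {ι : Type*} (v : Ell ι) : Op ι := InnerProductSpace.rankOne ℂ v v

/-- For `J ≃ ι × R`, the component of `ψ ∈ ℓ²(J)` in `ℓ²(ι)` at a fixed second index `r`. -/
def slice {J ι R : Type*} (e : J ≃ ι × R) (ψ : Ell J) (r : R) : Ell ι :=
  ⟨fun i => ψ (e.symm (i, r)), by
    apply memℓp_gen
    have h := (lp.memℓp ψ).summable (by simp)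
    exact h.comp_injective (i := fun i => e.symm (i, r)) (fun a b hab => by simpa using hab)⟩

theorem hasSum_norm_sq {ι : Type*} (f : Ell ι) : HasSum (fun i => ‖f i‖ ^ 2) (‖f‖ ^ 2) := by
  have h := lp.hasSum_norm (p := 2) (by simp) f
  simpa using h

theorem hasSum_slice {J ι R : Type*} (e : J ≃ ι × R) (ψ : Ell J) :
    HasSum (fun r => ‖slice e ψ r‖ ^ 2) (‖ψ‖ ^ 2) := by
  have h := hasSum_norm_sq ψ
  have h2 : HasSum (fun x : R × ι => ‖ψ (e.symm (x.2, x.1))‖ ^ 2) (‖ψ‖ ^ 2) :=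
    ((Equiv.prodComm R ι).trans e.symm).hasSum_iff.2 h
  exact h2.prod_fiberwise fun r => hasSum_norm_sq (slice e ψ r)

theorem summable_onFactor {J ι R : Type*} (e : J ≃ ι × R) (X : Op ι) (ψ : Ell J) :
    Summable (fun j => ‖X (slice e ψ (e j).2) (e j).1‖ ^ 2) ∧
      ∑' j, ‖X (slice e ψ (e j).2) (e j).1‖ ^ 2 ≤ (‖X‖ * ‖ψ‖) ^ 2 := by
  have hs := (hasSum_slice e ψ).mul_left (‖X‖ ^ 2)
  have hle : ∀ r, ‖X (slice e ψ r)‖ ^ 2 ≤ ‖X‖ ^ 2 * ‖slice e ψ r‖ ^ 2 := fun r => by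
    rw [← mul_pow]
    exact pow_le_pow_left₀ (norm_nonneg _) (X.le_opNorm _) 2
  have hr : Summable fun r => ‖X (slice e ψ r)‖ ^ 2 :=
    Summable.of_nonneg_of_le (fun r => by positivity) hle hs.summable
  have hin : ∀ r, HasSum (fun i => ‖X (slice e ψ r) i‖ ^ 2) (‖X (slice e ψ r)‖ ^ 2) :=
    fun r => hasSum_norm_sq _
  have hprod : Summable fun x : R × ι => ‖X (slice e ψ x.1) x.2‖ ^ 2 := by
    rw [summable_prod_of_nonneg (fun x => by positivity)]
    exact ⟨fun r => (hin r).summable, by simpa only [(hin _).tsum_eq] using hr⟩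
  have hsum := hprod.hasSum
  have hval := hsum.prod_fiberwise hin
  have hJ : HasSum (fun j => ‖X (slice e ψ (e j).2) (e j).1‖ ^ 2)
      (∑' x : R × ι, ‖X (slice e ψ x.1) x.2‖ ^ 2) :=
    (e.trans (Equiv.prodComm ι R)).hasSum_iff.2 hsum
  refine ⟨hJ.summable, ?_⟩
  rw [hJ.tsum_eq, mul_pow]
  exact hasSum_le hle hval hs

/-- The operator `X ⊗ 1` on `ℓ²(J) = ℓ²(ι) ⊗ ℓ²(R)`, for an identification `e : J ≃ ι × R`. -/
def onFactor {J ι R : Type*} (e : J ≃ ι × R) (X : Op ι) : Op J :=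
  LinearMap.mkContinuous
    { toFun := fun ψ => ⟨fun j => X (slice e ψ (e j).2) (e j).1, by
        apply memℓp_gen
        simpa using (summable_onFactor e X ψ).1⟩
      map_add' := fun ψ φ => by
        ext j
        have h : slice e (ψ + φ) (e j).2 = slice e ψ (e j).2 + slice e φ (e j).2 := rfl
        change X (slice e (ψ + φ) (e j).2) (e j).1 = _ + _
        rw [h, map_add]
        rfl
      map_smul' := fun c ψ => by
        ext j
        have h : slice e (c • ψ) (e j).2 = c • slice e ψ (e j).2 := rfl
        simp [h] }
    ‖X‖ fun ψ => by
      refine le_of_sq_le_sq ?_ (by positivity)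
      rw [← (hasSum_norm_sq _).tsum_eq]
      exact (summable_onFactor e X ψ).2

/-- `X ⊗ 1_B` on `AB`. -/
def opA {A κ : Type*} (X : Op A) : Op (A × κ) := onFactor (Equiv.refl (A × κ)) X

/-- `1_A ⊗ Y` on `AB`. -/
def opB {A κ : Type*} (Y : Op κ) : Op (A × κ) := onFactor (Equiv.prodComm A κ) Y

/-- `X ⊗ Y` on `AB`. -/
def tensorOp {A κ : Type*} (X : Op A) (Y : Op κ) : Op (A × κ) := opA X * opB Y

/-- The operator `X_1 ⊗ ⋯ ⊗ X_N` on the `N`-fold tensor power of `ℓ²(ι)`: the product of the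
(commuting) operators `1 ⊗ ⋯ ⊗ X_u ⊗ ⋯ ⊗ 1`. -/
def tensorPow {N : ℕ} {ι : Type*} (X : Fin N → Op ι) : Op (Fin N → ι) :=
  (List.ofFn fun u => onFactor (Equiv.piSplitAt u fun _ => ι) (X u)).prod

/-- A positive-operator-valued measure with finitely many outcomes. -/
structure POVM (O : Type*) [Fintype O] (ι : Type*) where
  effect : O → Op ι
  effect_nonneg : ∀ o, 0 ≤ effect o
  sum_effect : ∑ o, effect o = 1

/-- A density operator `ρ = ∑ k, |v_k⟩⟨v_k|` with `Tr ρ = ∑ k, ‖v_k‖² = 1`. By the spectral theorem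
these are exactly the positive trace-class operators of unit trace. -/
structure DensityOperator (ι : Type*) where
  vec : ℕ → Ell ι
  hasSum_norm : HasSum (fun k => ‖vec k‖ ^ 2) 1

/-- `Tr (T ρ)`, for self-adjoint `T`. -/
def DensityOperator.expect {ι : Type*} (ρ : DensityOperator ι) (T : Op ι) : ℝ :=
  ∑' k, (inner ℂ (ρ.vec k) (T (ρ.vec k))).re

/-! ### The virtual estimation protocol -/

/-- Bob's measurement bases: `0` is `Z`, the others are `X_1, …, X_{nM}`. -/
abbrev Basis (nM : ℕ) := Fin (nM + 1)

/-- Bob's outcomes `0`, `1`, and `none` for a non-detection. -/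
abbrev Bit := Option (Fin 2)

/-- The set `𝒦` of key triples `(i, β, b)`: `β = Z` and `i, b ∈ {0, 1}`. -/
def IsKey {nA nM : ℕ} (t : Fin (nA + 2) × Basis nM × Bit) : Prop :=
  t.2.1 = 0 ∧ (t.1 = 0 ∨ t.1 = 1) ∧ t.2.2 ≠ none

instance {nA nM : ℕ} : DecidablePred (@IsKey nA nM) := fun t => by
  unfold IsKey; infer_instance

/-- Single-round outcomes: `key i b` for a virtual key round, `test (i, β, b)` for a round with
`(i, β, b) ∉ 𝒦`, and `lwm k` for a local `W`-measurement round with the `k`-th eigenvector. -/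
inductive Outcome (nA nM : ℕ) : Type
  | key (i b : Fin 2) : Outcome nA nM
  | test (t : {t : Fin (nA + 2) × Basis nM × Bit // ¬ IsKey t}) : Outcome nA nM
  | lwm (k : Fin (nA + 2)) : Outcome nA nM

/-- Outcomes as a sum type. -/
def outcomeEquiv (nA nM : ℕ) :
    ((Fin 2 × Fin 2) ⊕ {t : Fin (nA + 2) × Basis nM × Bit // ¬ IsKey t} ⊕ Fin (nA + 2)) ≃
      Outcome nA nM where
  toFun
    | .inl (i, b) => .key i b
    | .inr (.inl t) => .test t
    | .inr (.inr k) => .lwm k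
  invFun
    | .key i b => .inl (i, b)
    | .test t => .inr (.inl t)
    | .lwm k => .inr (.inr k)
  left_inv := by rintro (⟨i, b⟩ | t | k) <;> rfl
  right_inv := by rintro (⟨i, b⟩ | t | k) <;> rfl

instance (nA nM : ℕ) : Fintype (Outcome nA nM) := Fintype.ofEquiv _ (outcomeEquiv nA nM)

/-- Data of a virtual estimation protocol with `nA + 2` settings for Alice, Bob's bases
`Z, X_1, …, X_{nM}`, `nQ` observables `Q_l`, and Bob's single-round Hilbert space `ℓ²(κ)`. -/
structure VEP (nA nM nQ : ℕ) (κ : Type*) where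
  /-- Probability that a round is a local `W`-measurement round. -/
  α : ℝ
  α_pos : 0 < α
  α_le_one : α ≤ 1
  /-- Bob's basis probabilities. -/
  pB : Basis nM → ℝ
  pB_pos : ∀ β, 0 < pB β
  sum_pB : ∑ β, pB β = 1
  /-- Bob's measurements. -/
  Γ : Basis nM → POVM Bit κ
  /-- Bob's virtual measurement. -/
  ΓV : POVM Bit κ
  ΓV_none : ΓV.effect none = (Γ 0).effect none
  /-- The coefficients `c^l_{i,β,b}`. -/
  c : Fin nQ → Fin (nA + 2) → Basis nM → Bit → ℝ
  /-- The coefficients agree on all key triples. -/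
  c_key : ∀ l i b i' b', IsKey (nM := nM) (i, 0, b) → IsKey (nM := nM) (i', 0, b') →
    c l i 0 b = c l i' 0 b'
  /-- Eigenvectors and eigenvalues of `W`. -/
  eigvec : OrthonormalBasis (Fin (nA + 2)) ℂ (Ell (Fin (nA + 2)))
  ω : Fin (nA + 2) → ℝ

/-- The Hadamard states `|0_X⟩ = (|0⟩ + |1⟩)/√2` and `|1_X⟩ = (|0⟩ - |1⟩)/√2` of Alice. -/
def ketX {nA : ℕ} (i : Fin 2) : Ell (Fin (nA + 2)) :=
  ((1 / √2 : ℝ) : ℂ) • (if i = 0 then ket 0 + ket 1 else ket 0 - ket 1)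

namespace VEP

variable {nA nM nQ : ℕ} {κ : Type*} (P : VEP nA nM nQ κ)

/-- The observable `W = ∑ ω |ω⟩⟨ω|` on Alice's ancilla. -/
def W : Op (Fin (nA + 2)) := ∑ k, ((P.ω k : ℝ) : ℂ) • ketbra (P.eigvec k)

/-- `S^{i,β,b} = p_β |i⟩⟨i| ⊗ Γ^{b|β}`. -/
def S (i : Fin (nA + 2)) (β : Basis nM) (b : Bit) : Op (Fin (nA + 2) × κ) :=
  ((P.pB β : ℝ) : ℂ) • tensorOp (ketbra (ket i)) ((P.Γ β).effect b)

/-- `V^{i,b} = p_Z |i_X⟩⟨i_X| ⊗ Γ^{b|V}`. -/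
def V (i b : Fin 2) : Op (Fin (nA + 2) × κ) :=
  ((P.pB 0 : ℝ) : ℂ) • tensorOp (ketbra (ketX i)) (P.ΓV.effect (some b))

/-- The phase-error operator. -/
def Eph : Op (Fin (nA + 2) × κ) := P.V 0 1 + P.V 1 0

/-- `Q^l = ∑ c^l_{i,β,b} |i⟩⟨i| ⊗ Γ^{b|β}`. -/
def Q (l : Fin nQ) : Op (Fin (nA + 2) × κ) :=
  ∑ i, ∑ β, ∑ b, ((P.c l i β b : ℝ) : ℂ) • tensorOp (ketbra (ket i)) ((P.Γ β).effect b)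

/-- The single-round POVM elements of the protocol. -/
def effect : Outcome nA nM → Op (Fin (nA + 2) × κ)
  | .key i b => ((1 - P.α : ℝ) : ℂ) • P.V i b
  | .test t => ((1 - P.α : ℝ) : ℂ) • P.S t.1.1 t.1.2.1 t.1.2.2
  | .lwm k => ((P.α : ℝ) : ℂ) • opA (ketbra (P.eigvec k))

/-- `χ_ph`: indicator of a phase error. -/
def chiPh : Outcome nA nM → ℝ
  | .key i b => if i ≠ b then 1 else 0
  | _ => 0

/-- `χ_{Q,l}`. -/
def chiQ (l : Fin nQ) : Outcome nA nM → ℝ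
  | .key _ _ => P.c l 0 0 (some 0) / P.pB 0
  | .test t => P.c l t.1.1 t.1.2.1 t.1.2.2 / P.pB t.1.2.1
  | .lwm _ => 0

/-- `χ_W`. -/
def chiW : Outcome nA nM → ℝ
  | .lwm k => P.ω k
  | _ => 0

variable {N : ℕ}

/-- Born rule: the probability that the `N` rounds have the outcomes `o 0, …, o (N - 1)`, when
Alice's and Bob's systems `A_1 B_1 ⋯ A_N B_N` are in the state `ρ`. -/
def outcomeProb (ρ : DensityOperator (Fin N → Fin (nA + 2) × κ)) (o : Fin N → Outcome nA nM) : ℝ :=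
  ρ.expect (tensorPow fun u => P.effect (o u))

open Classical in
/-- The probability of an event in the `N`-round protocol. -/
def prob (ρ : DensityOperator (Fin N → Fin (nA + 2) × κ)) (E : Set (Fin N → Outcome nA nM)) : ℝ :=
  ∑ o with o ∈ E, P.outcomeProb ρ o

/-- The number of phase errors. -/
def Mph (o : Fin N → Outcome nA nM) : ℝ := ∑ u, chiPh (o u)

/-- `M_{Q,l}`. -/
def MQ (l : Fin nQ) (o : Fin N → Outcome nA nM) : ℝ := ∑ u, P.chiQ l (o u)

/-- `M_W`. -/
def MW (o : Fin N → Outcome nA nM) : ℝ := ∑ u, P.chiW (o u)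

end VEP

/-- Smallest value of a function on the (finite, nonempty) set of single-round outcomes. -/
def minVal {nA nM : ℕ} (χ : Outcome nA nM → ℝ) : ℝ := ⨅ o, χ o

/-- Largest value of a function on the (finite, nonempty) set of single-round outcomes. -/
def maxVal {nA nM : ℕ} (χ : Outcome nA nM → ℝ) : ℝ := ⨆ o, χ o

/-! ### The functions from Kato's inequality

`N` is the number of rounds, `ε` the failure probability, `g` the guess for the normalized sum. -/

/-- `a_U`. -/
def aU (N g ε : ℝ) : ℝ :=
  3 * (72 * √N * g * (N - g) * Real.log ε - 16 * (N * √N) * Real.log ε ^ 2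
      + 9 * √2 * N *
        √(-(N - 2 * g) ^ 2 * Real.log ε * (9 * g * (N - g) - 2 * N * Real.log ε)))
    / (4 * (9 * N - 8 * Real.log ε) * (9 * g * (N - g) - 2 * N * Real.log ε))

/-- `b_U`, as a function of `a_U = a`. -/
def bU (N a ε : ℝ) : ℝ :=
  √(18 * a ^ 2 * N - (16 * a ^ 2 + 24 * a * √N + 9 * N) * Real.log ε) / (3 * √(2 * N))

/-- `a_L`. -/
def aL (N g ε : ℝ) : ℝ :=
  3 * (-72 * √N * g * (N - g) * Real.log ε + 16 * (N * √N) * Real.log ε ^ 2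
      + 9 * √2 * N *
        √(-(N - 2 * g) ^ 2 * Real.log ε * (9 * g * (N - g) - 2 * N * Real.log ε)))
    / (4 * (9 * N - 8 * Real.log ε) * (9 * g * (N - g) - 2 * N * Real.log ε))

/-- `b_L`, as a function of `a_L = a`. -/
def bL (N a ε : ℝ) : ℝ :=
  √(18 * a ^ 2 * N - (16 * a ^ 2 - 24 * a * √N + 9 * N) * Real.log ε) / (3 * √(2 * N))

/-- The deviation `[b + a (2 S / N - 1)] √N`. -/
def deviation (N a b S : ℝ) : ℝ := (b + a * (2 * S / N - 1)) * √N

/-- The normalization `n[S] = (S - N x_min) / (x_max - x_min)`. -/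
def normalize (N xmin xmax S : ℝ) : ℝ := (S - N * xmin) / (xmax - xmin)

/-- The lower Kato function `K^{-1}_{ε,N,xmin,xmax}(S)`, for a guess `g`. -/
def KMinus (ε N xmin xmax g S : ℝ) : ℝ :=
  S - (xmax - xmin) *
    deviation N (aL N g ε) (bL N (aL N g ε) ε) (normalize N xmin xmax S)

/-- The upper Kato function `K^{1}_{ε,N,xmin,xmax}(S)`, for a guess `g`. -/
def KPlus (ε N xmin xmax g S : ℝ) : ℝ :=
  S + (xmax - xmin) *
    deviation N (aU N g ε) (bU N (aU N g ε) ε) (normalize N xmin xmax S)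

/-- The nondecreasing version of `K^{1}_{ε,N,xmin,xmax}(S)`, in which `a_U` is replaced by
`max {-√N/2, a_U}`. It is equal to `KPlus` whenever `a_U ≥ -√N/2`. -/
def KPlusMono (ε N xmin xmax g S : ℝ) : ℝ :=
  S + (xmax - xmin) *
    deviation N (max (-√N / 2) (aU N g ε)) (bU N (max (-√N / 2) (aU N g ε)) ε)
      (normalize N xmin xmax S)

/-- `K^{sign(η)}_{ε,N,xmin,xmax}(S)`, where `sign(η) = 1` if `η ≥ 0` and `-1` otherwise. -/
def KSign (η ε N xmin xmax g S : ℝ) : ℝ :=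
  if 0 ≤ η then KPlus ε N xmin xmax g S else KMinus ε N xmin xmax g S

/-- `ã_U`, for a guess `g` of the sum of the conditional expectations of `χ_ph`. -/
def aTilde (N g ε : ℝ) : ℝ :=
  3 * √N / 4 *
    ((9 * √((N - 2 * g) ^ 2 * N * Real.log ε * (N * Real.log ε + 18 * g * (g - N)))
        + 4 * N * Real.log ε ^ 2
        + 9 * Real.log ε * (3 * N ^ 2 - 8 * N * g + 8 * g ^ 2))
      / (36 * Real.log ε * (N ^ 2 - 2 * N * g + 2 * g ^ 2)
        + 4 * N * Real.log ε ^ 2 + 81 * N * g * (N - g)))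

/-- `b̃_U`. -/
def bTilde (N g ε : ℝ) : ℝ :=
  √(18 * aTilde N g ε ^ 2 * N
      - (16 * aTilde N g ε ^ 2 - 24 * aTilde N g ε * √N + 9 * N) * Real.log ε) / (3 * √(2 * N))

/-- The upper bound `M_ph^U` on the number of phase errors, as a function of the outcomes through
the `M_{Q,l}` only. -/
def MphU {nA nM nQ N : ℕ} {κ : Type*} (P : VEP nA nM nQ κ) (η : Fin nQ → ℝ) (MWU εK : ℝ)
    (ε : Fin nQ → ℝ) (gQ : Fin nQ → ℝ) (gW gph : ℝ) (o : Fin N → Outcome nA nM) : ℝ :=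
  N / (√N - 2 * aTilde N gph εK) *
    (1 / √N *
      (∑ l, η l * KSign (η l) (ε l) N (minVal (P.chiQ l)) (maxVal (P.chiQ l)) (gQ l) (P.MQ l o)
        + (1 - P.α) / P.α * KPlusMono εK N (minVal P.chiW) (maxVal P.chiW) gW MWU)
      + bTilde N gph εK - aTilde N gph εK)

end QKD

end

noncomputable section

namespace QKD

/-! ### A lower bound on the binary relative entropy and the exponential tilt -/

/-! The operator inequality controls conditional expectations, and concentration transfers that
control to the observed counts.

Deterministic half (`VEP.condSum_chiPh_le`): given any history, the conditional mean of Σ η_l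
χ_{Q,l} + ((1-α)/α) χ_W - χ_ph is, up to normalization, the expectation of a tensor power whose
factor in the current round is (1-α)(Σ η_l Q_l + W ⊗ 1 - E_ph) ⪰ 0 and whose other factors are
positive effects. Since operators on distinct rounds commute, this tensor power is positive, so the
inequality between sums of conditional expectations holds on every outcome string, whatever the
correlations in ρ.

Probabilistic half (`weight_deviation_lt_condSum_sub_sum_le`): Kato's inequality for dependent
variables in [0,1]. With c = 1 + 2a/√N and d = (b - a)/√N, the bad event says that the sum of p_u -
cξ_u - d is positive, p_u being the conditional mean of ξ_u. A tilt s bounding each exponential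
moment by B gives probability at most B^N, and b is calibrated so that B^N = ε. The tilt comes from
`exists_exponential_tilt`: its optimal exponent is a Bernoulli relative entropy, which a sharpened
Pinsker inequality followed by AM-GM bounds in closed form. The estimate is valid for every real a,
so the formulas that turn guesses into a_U, a_L and ã_U only affect tightness.

The theorem follows by a union bound over the Kato failures and M_W > M_W^U, and by solving the
resulting affine inequality for M_ph. -/

theorem tangent_inv_mul_one_sub {t m : ℝ} (ht : 0 < t) (ht1 : t < 1) (hm : 0 < m) (hm1 : m < 1) :
    1 / (m * (1 - m)) - (1 - 2 * m) / (m * (1 - m)) ^ 2 * (t - m) ≤ 1 / (t * (1 - t)) := by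
  have hM : 0 < m * (1 - m) := mul_pos hm (by linarith)
  have hT : 0 < t * (1 - t) := mul_pos ht (by linarith)
  -- This product is exactly the gap in the tangent-line inequality after clearing denominators.
  have key : 0 ≤ (t - m) ^ 2 * ((1 - t) * (1 - m) ^ 2 + t * m ^ 2) := by
    have : 0 ≤ 1 - t := by linarith
    positivity
  have h1 : 1 / (m * (1 - m)) - (1 - 2 * m) / (m * (1 - m)) ^ 2 * (t - m)
      = (m * (1 - m) - (1 - 2 * m) * (t - m)) / (m * (1 - m)) ^ 2 := by
    have := hM.ne'
    field_simp
  rw [h1, div_le_div_iff₀ (by positivity) hT]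
  nlinarith [key]

/-- A refinement of Pinsker's inequality for Bernoulli distributions. -/
theorem sq_div_le_binary_relative_entropy {q p : ℝ} (hq : 0 < q) (hq1 : q < 1) (hp : 0 < p)
    (hp1 : p < 1) :
    (p - q) ^ 2 / (2 * ((q + 2 * p) / 3 * (1 - (q + 2 * p) / 3))) ≤
      q * (Real.log q - Real.log p) + (1 - q) * (Real.log (1 - q) - Real.log (1 - p)) := by
  -- The relative entropy is the integral from q to p of (t - q)/(t(1 - t)). The centroid of the
  -- weight t - q is m, so replacing the convex function 1/(t(1 - t)) by its tangent at m is
  -- Jensen's inequality: the linear term integrates to zero.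
  set m := (q + 2 * p) / 3 with hm
  have hm0 : 0 < m := by positivity
  have hm1 : m < 1 := by rw [hm]; linarith
  set A := 1 / (m * (1 - m)) with hA
  set k := (1 - 2 * m) / (m * (1 - m)) ^ 2 with hk
  -- The t-dependent part of the relative entropy minus an antiderivative of its tangent-line
  -- minorant. The derivative has the sign of t - q, so moving from q to p increases `F` whichever
  -- of them is larger.
  let F : ℝ → ℝ := fun t => -q * Real.log t - (1 - q) * Real.log (1 - t)
    - (A * ((t - q) ^ 2 / 2) - k * ((t - q) ^ 3 / 3 + (t - q) ^ 2 / 2 * (q - m)))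
  let F' : ℝ → ℝ := fun t => (t - q) * (1 / (t * (1 - t)) - (A - k * (t - m)))
  have hF : ∀ t, 0 < t → t < 1 → HasDerivAt F (F' t) t := by
    intro t ht ht1
    have h1 : HasDerivAt (fun t : ℝ => t - q) 1 t := (hasDerivAt_id t).sub_const q
    have h2 : HasDerivAt (fun t : ℝ => 1 - t) (-1) t := by
      simpa using (hasDerivAt_id t).const_sub 1
    have ht1' : 1 - t ≠ 0 := by linarith
    have h3 := (((Real.hasDerivAt_log ht.ne').const_mul (-q)).sub
      ((h2.log ht1').const_mul (1 - q))).sub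
      ((((h1.pow 2).div_const 2).const_mul A).sub
        ((((h1.pow 3).div_const 3).add (((h1.pow 2).div_const 2).mul_const (q - m))).const_mul k))
    refine h3.congr_deriv ?_
    simp only [F']
    have := ht.ne'
    field_simp
    push_cast
    ring
  have hsign : ∀ t, 0 < t → t < 1 → 0 ≤ 1 / (t * (1 - t)) - (A - k * (t - m)) :=
    fun t ht ht1 => sub_nonneg.2 (tangent_inv_mul_one_sub ht ht1 hm0 hm1)
  have hmain : F q ≤ F p := by
    rcases lt_trichotomy q p with h | h | h
    · obtain ⟨x, hx, hx'⟩ := exists_hasDerivAt_eq_slope F F' h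
        (fun t ht => (hF t (by linarith [ht.1]) (by linarith [ht.2])).continuousAt.continuousWithinAt)
        (fun t ht => hF t (by linarith [ht.1]) (by linarith [ht.2]))
      have h0 : 0 ≤ F' x := mul_nonneg (by linarith [hx.1])
        (hsign x (by linarith [hx.1]) (by linarith [hx.2]))
      rw [hx', div_nonneg_iff] at h0
      rcases h0 with h0 | h0 <;> linarith
    · rw [h]
    · obtain ⟨x, hx, hx'⟩ := exists_hasDerivAt_eq_slope F F' h
        (fun t ht => (hF t (by linarith [ht.1]) (by linarith [ht.2])).continuousAt.continuousWithinAt)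
        (fun t ht => hF t (by linarith [ht.1]) (by linarith [ht.2]))
      have h0 : F' x ≤ 0 := mul_nonpos_of_nonpos_of_nonneg (by linarith [hx.2])
        (hsign x (by linarith [hx.1]) (by linarith [hx.2]))
      rw [hx', div_nonpos_iff] at h0
      rcases h0 with h0 | h0 <;> linarith
  have e1 : F p = -q * Real.log p - (1 - q) * Real.log (1 - p) - A * ((p - q) ^ 2 / 2) := by
    simp only [F, hm]; ring
  have e2 : F q = -q * Real.log q - (1 - q) * Real.log (1 - q) := by
    simp only [F]; ring
  have e3 : (p - q) ^ 2 / (2 * (m * (1 - m))) = A * ((p - q) ^ 2 / 2) := by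
    rw [hA, div_mul_div_comm, one_mul, mul_comm (m * (1 - m))]
  rw [e3]
  rw [e1, e2] at hmain
  linarith

/-- AM-GM. Put m = (q + 2p)/3, x = p - cq and y = x + c - 1; then (1 - m)x + my = (p - q)(1 + 2c)/3,
and 4m(1 - m)xy is at most its square. -/
theorem deviation_rate_le {c q p : ℝ} (hc : 0 < c) (hq : 0 < q) (hq1 : q < 1) (hp : 0 < p)
    (hp1 : p < 1) :
    18 * (p - c * q) * (p - c * q + c - 1) / (1 + 2 * c) ^ 2 ≤
      (p - q) ^ 2 / (2 * ((q + 2 * p) / 3 * (1 - (q + 2 * p) / 3))) := by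
  have hm : 0 < (q + 2 * p) / 3 * (1 - (q + 2 * p) / 3) := mul_pos (by positivity) (by linarith)
  rw [div_le_div_iff₀ (by positivity) (by positivity)]
  have h := sq_nonneg ((3 - q - 2 * p) * (p - c * q) - (q + 2 * p) * (p - c * q + c - 1))
  nlinarith [h]

/-- There is a tilt `s` at which the exponential moment of `p - c ξ - d`, for `ξ` Bernoulli with
mean `p`, is bounded uniformly in `p`. -/
theorem exists_exponential_tilt {c d : ℝ} (hc : 0 < c) (hd : 0 < d) (hd1 : d < 1)
    (hdc : 1 - c < d) :
    ∃ s : ℝ, 0 < s ∧ ∀ p, 0 ≤ p → p ≤ 1 →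
      Real.exp (s * (p - d)) * (1 - p + p * Real.exp (-(s * c))) ≤
        Real.exp (-(18 * d * (d + c - 1) / (1 + 2 * c) ^ 2)) := by
  let r : ℝ → ℝ := fun s => 1 - Real.exp (-(s * c))
  have hr0 : ∀ s, 0 < s → 0 < r s := fun s hs => by
    have : Real.exp (-(s * c)) < 1 := by
      rw [← Real.exp_zero]
      exact Real.exp_lt_exp.2 (by have := mul_pos hs hc; linarith)
    simp only [r]; linarith
  have hr1 : ∀ s, r s < 1 := fun s => by
    have := Real.exp_pos (-(s * c)); simp only [r]; linarith
  have hrc : Continuous r := by fun_prop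
  -- The exponent s(p - d) + log(1 - p r) is concave in p with critical point 1/r - 1/s. Clamping to
  -- [0,1] keeps it a probability for every s.
  let P : ℝ → ℝ := fun s => max 0 (min 1 (1 / r s - 1 / s))
  have hP0 : ∀ s, 0 ≤ P s := fun s => le_max_left _ _
  have hP1 : ∀ s, P s ≤ 1 := fun s => max_le zero_le_one (min_le_left _ _)
  have hPr : ∀ s, 0 < s → 0 < 1 - P s * r s := fun s hs => by
    nlinarith [hP0 s, hP1 s, hr0 s hs, hr1 s]
  -- The quotient is the mean of a Bernoulli variable of parameter `P s` after tilting by exp(-sc).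
  -- The right s solves `D s = d`, found by the intermediate value theorem.
  let D : ℝ → ℝ := fun s => P s - c * (P s * (1 - r s) / (1 - P s * r s))
  have hPc : ContinuousOn P (Set.Ioi 0) := by
    refine ContinuousOn.sup continuousOn_const
      (ContinuousOn.inf continuousOn_const (ContinuousOn.sub ?_ ?_))
    · exact continuousOn_const.div hrc.continuousOn fun s hs => (hr0 s hs).ne'
    · exact continuousOn_const.div continuousOn_id fun s hs => ne_of_gt hs
  have hDc : ContinuousOn D (Set.Ioi 0) :=
    hPc.sub (continuousOn_const.mul ((hPc.mul (continuousOn_const.sub hrc.continuousOn)).div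
      (continuousOn_const.sub (hPc.mul hrc.continuousOn)) fun s hs => (hPr s hs).ne'))
  -- small tilts
  obtain ⟨s₁, hs₁, hD₁⟩ : ∃ s, 0 < s ∧ D s ≤ d := by
    have hlim : Filter.Tendsto (fun s => 1 - c + c * r s) (nhdsWithin 0 (Set.Ioi 0))
        (nhds (1 - c)) := by
      have : Continuous fun s => 1 - c + c * r s := by fun_prop
      have h := this.tendsto 0
      simp only [r, zero_mul, neg_zero, Real.exp_zero, sub_self, mul_zero, add_zero] at h
      exact h.mono_left nhdsWithin_le_nhds
    obtain ⟨s, hs, hs0⟩ := ((hlim.eventually (gt_mem_nhds hdc)).and self_mem_nhdsWithin).exists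
    have hs0 : 0 < s := hs0
    refine ⟨s, hs0, ?_⟩
    have h1 : P s * (1 - r s) ≤ P s * (1 - r s) / (1 - P s * r s) := by
      rw [le_div_iff₀ (hPr s hs0)]
      have : 0 ≤ P s * (1 - r s) * (P s * r s) :=
        mul_nonneg (mul_nonneg (hP0 s) (by linarith [hr1 s])) (mul_nonneg (hP0 s) (hr0 s hs0).le)
      linarith
    have h2 : D s ≤ P s * (1 - c + c * r s) := by
      simp only [D]; nlinarith
    nlinarith [hP0 s, hP1 s]
  -- large tilts
  obtain ⟨s₂, hs₂, hD₂⟩ : ∃ s, 0 < s ∧ d ≤ D s := by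
    have hmul : Filter.Tendsto (fun s : ℝ => s * c) Filter.atTop Filter.atTop :=
      Filter.tendsto_id.atTop_mul_const hc
    have he : Filter.Tendsto (fun s : ℝ => Real.exp (-(s * c))) Filter.atTop (nhds 0) :=
      (Real.tendsto_exp_neg_atTop_nhds_zero).comp hmul
    have hse : Filter.Tendsto (fun s : ℝ => s * Real.exp (-(s * c))) Filter.atTop (nhds 0) := by
      have h := ((Real.tendsto_pow_mul_exp_neg_atTop_nhds_zero 1).comp hmul).const_mul (1 / c)
      rw [mul_zero] at h
      refine h.congr fun s => ?_
      simp only [Function.comp, pow_one]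
      field_simp
    have hrl : Filter.Tendsto r Filter.atTop (nhds 1) := by
      simpa using he.const_sub 1
    have hPl : Filter.Tendsto (fun s => 1 / r s - 1 / s) Filter.atTop (nhds 1) := by
      have h1 : Filter.Tendsto (fun s => 1 / r s) Filter.atTop (nhds (1 / 1)) :=
        tendsto_const_nhds.div hrl one_ne_zero
      have h2 : Filter.Tendsto (fun s : ℝ => 1 / s) Filter.atTop (nhds 0) := by
        simpa using tendsto_inv_atTop_zero (𝕜 := ℝ)
      simpa using h1.sub h2
    have hQl : Filter.Tendsto (fun s => (1 / r s - 1 / s)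
        - c * ((1 / r s - 1 / s) * ((s * Real.exp (-(s * c))) / r s))) Filter.atTop (nhds 1) := by
      simpa using hPl.sub ((hPl.mul (hse.div hrl one_ne_zero)).const_mul c)
    obtain ⟨s, ⟨⟨h1, h2⟩, h3⟩, hs⟩ := (((hQl.eventually (lt_mem_nhds hd1)).and
      (hPl.eventually (lt_mem_nhds zero_lt_one))).and
      ((hse.sub hrl).eventually (gt_mem_nhds (show (0 : ℝ) - 1 < 0 by norm_num)))).and
      (Filter.eventually_gt_atTop 0) |>.exists
    refine ⟨s, hs, ?_⟩
    have hr := hr0 s hs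
    have hPs : P s = 1 / r s - 1 / s := by
      simp only [P]
      rw [min_eq_right, max_eq_right h2.le]
      have : 1 / r s - 1 / s - 1 = (s * (1 - r s) - r s) / (r s * s) := by
        field_simp; ring
      have h4 : (s * (1 - r s) - r s) / (r s * s) ≤ 0 :=
        div_nonpos_of_nonpos_of_nonneg (by simp only [r] at h3 ⊢; linarith) (by positivity)
      linarith
    have h5 : 1 - P s * r s = r s / s := by
      rw [hPs]; field_simp; ring
    have h6 : D s = (1 / r s - 1 / s)
        - c * ((1 / r s - 1 / s) * ((s * Real.exp (-(s * c))) / r s)) := by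
      simp only [D]
      rw [h5, hPs, show Real.exp (-(s * c)) = 1 - r s by simp only [r]; ring]
      field_simp
    rw [h6]
    exact h1.le
  obtain ⟨s, hs, hDs⟩ : ∃ s, 0 < s ∧ D s = d := by
    have hpre : IsPreconnected (Set.Ioi (0 : ℝ)) := isPreconnected_Ioi
    obtain ⟨s, hs, h⟩ := hpre.intermediate_value hs₁ hs₂ hDc ⟨hD₁, hD₂⟩
    exact ⟨s, hs, h⟩
  have hr := hr0 s hs
  have hr' := hr1 s
  have hpr := hPr s hs
  -- Clamped values would give `D s = 0` or `D s = 1 - c`, both excluded as d > 0 and d > 1 - c.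
  -- Hence `P s` is the genuine critical point.
  have hne0 : P s ≠ 0 := fun h => by
    simp only [D, h] at hDs; simp at hDs; linarith
  have hne1 : P s ≠ 1 := fun h => by
    simp only [D, h, one_mul] at hDs
    rw [div_self (by linarith)] at hDs; linarith
  have hp0 : 0 < P s := lt_of_le_of_ne (hP0 s) (Ne.symm hne0)
  have hp1 : P s < 1 := lt_of_le_of_ne (hP1 s) hne1
  have hPs : P s = 1 / r s - 1 / s := by
    simp only [P] at hp0 hp1 ⊢
    rcases le_total (1 / r s - 1 / s) 1 with h | h
    · rw [min_eq_right h] at hp0 ⊢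
      rw [max_eq_right]
      by_contra hcon
      rw [max_eq_left (not_le.1 hcon).le] at hp0
      exact lt_irrefl _ hp0
    · rw [min_eq_left h, max_eq_right zero_le_one] at hp1
      exact absurd hp1 (lt_irrefl _)
  have h5 : 1 - P s * r s = r s / s := by
    rw [hPs]; field_simp; ring
  set p' := P s with hp'
  set R := r s with hR
  set q' := p' * (1 - R) / (1 - p' * R) with hq'
  have hq0 : 0 < q' := div_pos (mul_pos hp0 (by linarith)) hpr
  have hq1' : 1 - q' = (1 - p') / (1 - p' * R) := by
    rw [hq', eq_div_iff hpr.ne', sub_mul, div_mul_cancel₀ _ hpr.ne']; ring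
  have hq1 : q' < 1 := by
    have : 0 < (1 - p') / (1 - p' * R) := div_pos (by linarith) hpr
    linarith
  have hd' : d = p' - c * q' := hDs.symm
  have hlogR : Real.log (1 - R) = -(s * c) := by
    rw [show 1 - R = Real.exp (-(s * c)) by simp only [hR, r]; ring, Real.log_exp]
  -- As d = p' - c q', the exponent at p' equals minus this relative entropy.
  have hent : q' * (Real.log q' - Real.log p') + (1 - q') * (Real.log (1 - q') - Real.log (1 - p'))
      = -(s * c) * q' - Real.log (1 - p' * R) := by
    have e1 : Real.log q' = Real.log p' + Real.log (1 - R) - Real.log (1 - p' * R) := by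
      rw [hq', Real.log_div (mul_pos hp0 (by linarith)).ne' hpr.ne',
        Real.log_mul hp0.ne' (by linarith)]
    have e2 : Real.log (1 - q') = Real.log (1 - p') - Real.log (1 - p' * R) := by
      rw [hq1', Real.log_div (by linarith) hpr.ne']
    rw [e1, e2, hlogR]; ring
  have hbound := (deviation_rate_le hc hq0 hq1 hp0 hp1).trans
    (sq_div_le_binary_relative_entropy hq0 hq1 hp0 hp1)
  rw [hent, ← hd'] at hbound
  refine ⟨s, hs, fun p hp hp1 => ?_⟩
  have hx : 0 < 1 - p * R := by nlinarith
  have e : 1 - p + p * Real.exp (-(s * c)) = 1 - p * R := by simp only [hR, r]; ring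
  rw [e, ← Real.exp_log hx, ← Real.exp_add]
  refine Real.exp_le_exp.2 ?_
  -- Concavity of log: the tangent in p at p' has slope -R/(1 - p'R) = -s, so p' maximizes the
  -- exponent over p.
  have hlog : Real.log (1 - p * R) ≤ s * (p' - p) + Real.log (1 - p' * R) := by
    have h := Real.log_le_sub_one_of_pos (div_pos hx hpr)
    rw [Real.log_div hx.ne' hpr.ne'] at h
    have : (1 - p * R) / (1 - p' * R) - 1 = s * (p' - p) := by
      rw [div_sub_one hpr.ne', show 1 - p * R - (1 - p' * R) = (p' - p) * R by ring, h5]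
      field_simp
    linarith
  have hsd : s * (p' - d) = s * c * q' := by rw [hd']; ring
  nlinarith [hlog, hbound, hsd]

/-! ### Operators acting on a tensor factor -/

theorem mul_nonneg_of_commute {H : Type*} [NormedAddCommGroup H] [InnerProductSpace ℂ H]
    [CompleteSpace H] {S T : H →L[ℂ] H} (hS : 0 ≤ S) (hT : 0 ≤ T) (h : Commute S T) :
    0 ≤ S * T :=
  Commute.mul_nonneg hS hT h

section OnFactor

variable {J ι R : Type*}

theorem onFactor_apply (e : J ≃ ι × R) (X : Op ι) (ψ : Ell J) (j : J) :
    onFactor e X ψ j = X (slice e ψ (e j).2) (e j).1 := rfl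

theorem slice_onFactor (e : J ≃ ι × R) (X : Op ι) (ψ : Ell J) (r : R) :
    slice e (onFactor e X ψ) r = X (slice e ψ r) := by
  ext i
  change X (slice e ψ (e (e.symm (i, r))).2) (e (e.symm (i, r))).1 = _
  rw [Equiv.apply_symm_apply]

/-- `X ↦ X ⊗ 1` as a linear map. -/
def onFactorₗ (e : J ≃ ι × R) : Op ι →ₗ[ℂ] Op J where
  toFun := onFactor e
  map_add' X Y := by ext ψ j; rfl
  map_smul' c X := by ext ψ j; rfl

@[simp]
theorem onFactorₗ_apply (e : J ≃ ι × R) (X : Op ι) : onFactorₗ e X = onFactor e X := rfl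

@[simp]
theorem onFactor_one (e : J ≃ ι × R) : onFactor e (1 : Op ι) = 1 := by
  ext ψ j
  change ψ (e.symm ((e j).1, (e j).2)) = ψ j
  simp

theorem hasSum_inner_slice (e : J ≃ ι × R) (φ ψ : Ell J) :
    HasSum (fun r => inner ℂ (slice e φ r) (slice e ψ r)) (inner ℂ φ ψ) := by
  have h : HasSum (fun x : R × ι => inner ℂ (φ (e.symm (x.2, x.1))) (ψ (e.symm (x.2, x.1))))
      (inner ℂ φ ψ) :=
    ((Equiv.prodComm R ι).trans e.symm).hasSum_iff.2 (lp.hasSum_inner φ ψ)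
  exact h.prod_fiberwise fun r => lp.hasSum_inner (slice e φ r) (slice e ψ r)

/-- Inner products are sums over slices, and the operator acts on each slice separately by X. -/
theorem onFactor_nonneg (e : J ≃ ι × R) {X : Op ι} (hX : 0 ≤ X) : 0 ≤ onFactor e X := by
  rw [ContinuousLinearMap.nonneg_iff_isPositive] at hX ⊢
  rw [ContinuousLinearMap.isPositive_def]
  refine ⟨fun φ ψ => ?_, fun ψ => ?_⟩
  · have h1 := hasSum_inner_slice e (onFactor e X φ) ψ
    have h2 := hasSum_inner_slice e φ (onFactor e X ψ)
    simp only [slice_onFactor, hX.inner_left_eq_inner_right] at h1 h2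
    exact h1.unique h2
  · have h1 := hasSum_inner_slice e (onFactor e X ψ) ψ
    simp only [slice_onFactor] at h1
    have h2 := Complex.hasSum_re h1
    exact h2.nonneg fun r => hX.re_inner_nonneg_left _

open Classical in
theorem slice_single (e : J ≃ ι × R) (j : J) (r : R) :
    slice e (lp.single 2 j (1 : ℂ)) r =
      if r = (e j).2 then lp.single 2 (e j).1 (1 : ℂ) else 0 := by
  ext i
  change (lp.single 2 j (1 : ℂ) : Ell J) (e.symm (i, r)) = _
  split_ifs with h
  · subst h
    simp only [lp.single_apply, Pi.single_apply]
    refine if_congr ?_ rfl rfl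
    rw [Equiv.symm_apply_eq, Prod.ext_iff]
    simp
  · rw [lp.single_apply_ne]
    · rfl
    · rintro rfl
      simp at h

-- A bounded operator is determined on basis vectors because ψ is the norm limit of its finite
-- expansions.
open Classical in
theorem op_ext {T S : Op J} (h : ∀ j, T (lp.single 2 j (1 : ℂ)) = S (lp.single 2 j (1 : ℂ))) :
    T = S := by
  ext1 ψ
  have hs := lp.hasSum_single (p := 2) (by simp) ψ
  refine (hs.mapL T).unique ?_
  convert hs.mapL S using 2 with j
  have : (lp.single 2 j (ψ j) : Ell J) = ψ j • lp.single 2 j (1 : ℂ) := by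
    rw [← lp.single_smul, smul_eq_mul, mul_one]
  rw [this, map_smul, map_smul, h]

-- Matrix entry between basis vectors j and k. Read `e.symm (i, (e k).2)` as k with its ι-coordinate
-- replaced by i; the hypotheses say that replacing one factor's coordinate leaves the other
-- factor's unchanged. The entry is a product of single-factor entries when j and k agree off both
-- factors, and zero otherwise.
open Classical in
theorem onFactor_onFactor_single {ι' R' : Type*} (e : J ≃ ι × R) (e' : J ≃ ι' × R')
    (h1 : ∀ k i, (e (e'.symm (i, (e' k).2))).1 = (e k).1)
    (h2 : ∀ k i, (e' (e.symm (i, (e k).2))).1 = (e' k).1)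
    (X : Op ι) (Y : Op ι') (j k : J) :
    onFactor e X (onFactor e' Y (lp.single 2 j (1 : ℂ))) k =
      if e.symm ((e j).1, (e k).2) = e'.symm ((e' k).1, (e' j).2) then
        X (lp.single 2 (e j).1 (1 : ℂ)) (e k).1 * Y (lp.single 2 (e' j).1 (1 : ℂ)) (e' k).1
      else 0 := by
  have hs : slice e (onFactor e' Y (lp.single 2 j (1 : ℂ))) (e k).2 =
      (if e.symm ((e j).1, (e k).2) = e'.symm ((e' k).1, (e' j).2) then
        Y (lp.single 2 (e' j).1 (1 : ℂ)) (e' k).1 else 0) • lp.single 2 (e j).1 (1 : ℂ) := by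
    ext i
    change onFactor e' Y (lp.single 2 j (1 : ℂ)) (e.symm (i, (e k).2)) = _ * _
    rw [onFactor_apply, h2, slice_single]
    by_cases hi : i = (e j).1
    · subst hi
      rw [lp.single_apply_self, mul_one]
      have hiff : (e' (e.symm ((e j).1, (e k).2))).2 = (e' j).2 ↔
          e.symm ((e j).1, (e k).2) = e'.symm ((e' k).1, (e' j).2) := by
        rw [Equiv.eq_symm_apply, Prod.ext_iff]
        simp [h2]
      by_cases hc : (e' (e.symm ((e j).1, (e k).2))).2 = (e' j).2
      · rw [if_pos hc, if_pos (hiff.1 hc)]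
      · rw [if_neg hc, if_neg (mt hiff.2 hc), map_zero]; rfl
    · rw [lp.single_apply_ne _ _ _ hi, mul_zero, if_neg, map_zero]
      · rfl
      · intro hc
        apply hi
        have h3 := h1 j (e' (e.symm (i, (e k).2))).1
        rw [← hc] at h3
        simpa using h3
  rw [onFactor_apply, hs, map_smul, lp.coeFn_smul, Pi.smul_apply, smul_eq_mul]
  split_ifs <;> ring

/-- Operators on different tensor factors commute. -/
theorem commute_onFactor {ι' R' : Type*} (e : J ≃ ι × R) (e' : J ≃ ι' × R')
    (h1 : ∀ k i, (e (e'.symm (i, (e' k).2))).1 = (e k).1)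
    (h2 : ∀ k i, (e' (e.symm (i, (e k).2))).1 = (e' k).1)
    (h3 : ∀ k i i', e'.symm (i', (e' (e.symm (i, (e k).2))).2) =
      e.symm (i, (e (e'.symm (i', (e' k).2))).2))
    (X : Op ι) (Y : Op ι') : Commute (onFactor e X) (onFactor e' Y) := by
  classical
  refine op_ext fun j => ?_
  ext k
  change onFactor e X (onFactor e' Y (lp.single 2 j (1 : ℂ))) k =
    onFactor e' Y (onFactor e X (lp.single 2 j (1 : ℂ))) k
  rw [onFactor_onFactor_single e e' h1 h2, onFactor_onFactor_single e' e h2 h1, mul_comm]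
  -- The two products of entries coincide, so only the symmetry of the support condition remains; it
  -- rests on the commutation `h3` of the coordinate replacements.
  refine if_congr ⟨fun h => ?_, fun h => ?_⟩ rfl rfl
  · have a : k = e.symm ((e k).1, (e (e'.symm ((e' k).1, (e' j).2))).2) := by
      rw [← h]; simp
    rw [← h3] at a
    conv_lhs => rw [a]
    simp only [Equiv.apply_symm_apply]
    rw [← h2 j (e k).1, Prod.mk.eta, Equiv.symm_apply_apply]
  · have a : k = e'.symm ((e' k).1, (e' (e.symm ((e k).1, (e j).2))).2) := by
      rw [← h]; simp
    rw [h3] at a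
    conv_lhs => rw [a]
    simp only [Equiv.apply_symm_apply]
    rw [← h1 j (e' k).1, Prod.mk.eta, Equiv.symm_apply_apply]

end OnFactor

/-! ### Products of two tensor factors -/

section Tensor

variable {A κ : Type*}

theorem opA_nonneg {X : Op A} (hX : 0 ≤ X) : 0 ≤ (opA X : Op (A × κ)) := onFactor_nonneg _ hX

theorem commute_opA_opB (X : Op A) (Y : Op κ) : Commute (opA X) (opB Y) :=
  commute_onFactor _ _ (fun _ _ => rfl) (fun _ _ => rfl) (fun _ _ _ => rfl) X Y

theorem tensorOp_nonneg {X : Op A} {Y : Op κ} (hX : 0 ≤ X) (hY : 0 ≤ Y) : 0 ≤ tensorOp X Y :=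
  mul_nonneg_of_commute (onFactor_nonneg _ hX) (onFactor_nonneg _ hY) (commute_opA_opB X Y)

/-- `(X, Y) ↦ X ⊗ Y` as a bilinear map. -/
def tensorOpₗ : Op A →ₗ[ℂ] Op κ →ₗ[ℂ] Op (A × κ) :=
  (LinearMap.mul ℂ (Op (A × κ))).compl₁₂ (onFactorₗ (Equiv.refl (A × κ)))
    (onFactorₗ (Equiv.prodComm A κ))

theorem tensorOpₗ_apply (X : Op A) (Y : Op κ) : tensorOpₗ X Y = tensorOp X Y := rfl

theorem tensorOp_one (X : Op A) : tensorOp X (1 : Op κ) = opA X := by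
  simp [tensorOp, opB]

end Tensor

/-! ### Tensor powers over the rounds -/

section TensorPow

variable {N : ℕ} {ι : Type*}

/-- Turns coordinate replacement into `Function.update`, whose commutation at distinct indices is
what the general commutation criterion needs. -/
theorem piSplitAt_symm (u : Fin N) (k : Fin N → ι) (i : ι) :
    (Equiv.piSplitAt u fun _ => ι).symm (i, (Equiv.piSplitAt u (fun _ => ι) k).2) =
      Function.update k u i := by
  ext v
  simp only [Equiv.piSplitAt, Equiv.coe_fn_symm_mk, Equiv.coe_fn_mk, Function.update_apply]
  split_ifs with h
  · subst h; rfl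
  · rfl

theorem commute_onFactor_piSplitAt {u v : Fin N} (huv : u ≠ v) (X Y : Op ι) :
    Commute (onFactor (Equiv.piSplitAt u fun _ => ι) X)
      (onFactor (Equiv.piSplitAt v fun _ => ι) Y) := by
  have h0 : ∀ (w : Fin N) (k : Fin N → ι), (Equiv.piSplitAt w (fun _ => ι) k).1 = k w :=
    fun _ _ => rfl
  refine commute_onFactor _ _ (fun k i => ?_) (fun k i => ?_) (fun k i i' => ?_) X Y
  · rw [piSplitAt_symm, h0, h0, Function.update_of_ne huv]
  · rw [piSplitAt_symm, h0, h0, Function.update_of_ne huv.symm]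
  · simp only [piSplitAt_symm]
    exact Function.update_comm huv _ _ _

/-- The tensor power as a multilinear map. -/
def tensorPowₘ : MultilinearMap ℂ (fun _ : Fin N => Op ι) (Op (Fin N → ι)) :=
  (MultilinearMap.mkPiAlgebraFin ℂ N (Op (Fin N → ι))).compLinearMap
    fun u => onFactorₗ (Equiv.piSplitAt u fun _ => ι)

theorem tensorPowₘ_apply (X : Fin N → Op ι) : tensorPowₘ X = tensorPow X := by
  simp [tensorPowₘ, tensorPow]

theorem tensorPow_one : tensorPow (fun _ : Fin N => (1 : Op ι)) = 1 := by
  simp [tensorPow]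

theorem list_prod_nonneg {J : Type*} (l : List (Op J)) (h : ∀ T ∈ l, 0 ≤ T)
    (hc : l.Pairwise Commute) : 0 ≤ l.prod := by
  induction l with
  | nil => simp
  | cons T l ih =>
    rw [List.pairwise_cons] at hc
    rw [List.prod_cons]
    exact mul_nonneg_of_commute (h T (by simp)) (ih (fun S hS => h S (by simp [hS])) hc.2)
      (Commute.list_prod_right _ _ hc.1)

/-- A product of positive operators is positive once they commute pairwise, which holds here because
they sit on distinct rounds. -/
theorem tensorPow_nonneg {X : Fin N → Op ι} (hX : ∀ u, 0 ≤ X u) : 0 ≤ tensorPow X := by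
  refine list_prod_nonneg _ (fun T hT => ?_) ?_
  · obtain ⟨u, rfl⟩ := (List.mem_ofFn' _ _).1 hT
    exact onFactor_nonneg _ (hX u)
  · rw [List.pairwise_ofFn]
    exact fun u v huv => commute_onFactor_piSplitAt huv.ne _ _

end TensorPow

/-! ### Expectation values -/

section Expect

variable {ι : Type*} (ρ : DensityOperator ι)

theorem DensityOperator.summable_expect (T : Op ι) :
    Summable fun k => (inner ℂ (ρ.vec k) (T (ρ.vec k))).re := by
  refine Summable.of_norm_bounded (ρ.hasSum_norm.summable.mul_left ‖T‖) fun k => ?_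
  calc ‖(inner ℂ (ρ.vec k) (T (ρ.vec k))).re‖ ≤ ‖inner ℂ (ρ.vec k) (T (ρ.vec k))‖ :=
        Complex.abs_re_le_norm _
    _ ≤ ‖ρ.vec k‖ * ‖T (ρ.vec k)‖ := norm_inner_le_norm _ _
    _ ≤ ‖ρ.vec k‖ * (‖T‖ * ‖ρ.vec k‖) := by gcongr; exact T.le_opNorm _
    _ = ‖T‖ * ‖ρ.vec k‖ ^ 2 := by ring

/-- `T ↦ Tr (T ρ)` as a real linear map. -/
def DensityOperator.expectₗ : Op ι →ₗ[ℝ] ℝ where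
  toFun := ρ.expect
  map_add' T S := by
    simp only [DensityOperator.expect]
    rw [← (ρ.summable_expect T).tsum_add (ρ.summable_expect S)]
    congr! 2 with k
    rw [← Complex.add_re, ← inner_add_right]
    rfl
  map_smul' c T := by
    simp only [DensityOperator.expect, RingHom.id_apply, smul_eq_mul]
    rw [← tsum_mul_left]
    congr! 2 with k
    change (inner ℂ (ρ.vec k) (((c : ℝ) : ℂ) • T (ρ.vec k))).re = _
    rw [inner_smul_right, Complex.re_ofReal_mul]

theorem DensityOperator.expectₗ_apply (T : Op ι) : ρ.expectₗ T = ρ.expect T := rfl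

theorem DensityOperator.expect_nonneg {T : Op ι} (hT : 0 ≤ T) : 0 ≤ ρ.expect T := by
  rw [ContinuousLinearMap.nonneg_iff_isPositive] at hT
  exact tsum_nonneg fun k => hT.re_inner_nonneg_right _

theorem DensityOperator.expect_one : ρ.expect 1 = 1 := by
  rw [← ρ.hasSum_norm.tsum_eq]
  refine tsum_congr fun k => ?_
  simpa using inner_self_eq_norm_sq (𝕜 := ℂ) (ρ.vec k)

end Expect

/-! ### Finite stochastic processes and Kato's inequality -/

section FiniteProcess

variable {O : Type*} [Fintype O]

theorem sum_cons {N : ℕ} (f : (Fin (N + 1) → O) → ℝ) :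
    ∑ o, f o = ∑ x, ∑ o', f (Fin.cons x o') := by
  rw [← (Fin.consEquiv fun _ : Fin (N + 1) => O).sum_comp f, Fintype.sum_prod_type]
  rfl

/-- The sum over the rounds of the conditional expectations of `ξ` given the earlier rounds, for
a process whose outcomes `o` have the (possibly unnormalized) weights `w o`. -/
def condSum (ξ : O → ℝ) : (N : ℕ) → ((Fin N → O) → ℝ) → (Fin N → O) → ℝ
  | 0, _, _ => 0
  | N + 1, w, o =>
    (∑ x, ξ x * ∑ o', w (Fin.cons x o')) / (∑ x, ∑ o', w (Fin.cons x o')) +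
      condSum ξ N (fun o' => w (Fin.cons (o 0) o')) (Fin.tail o)

theorem condSum_add (ξ ζ : O → ℝ) {N : ℕ} (w : (Fin N → O) → ℝ) (o : Fin N → O) :
    condSum (fun x => ξ x + ζ x) N w o = condSum ξ N w o + condSum ζ N w o := by
  induction N with
  | zero => simp [condSum]
  | succ N ih =>
    simp only [condSum, ih, add_mul, Finset.sum_add_distrib, add_div]
    ring

theorem condSum_mul_left (a : ℝ) (ξ : O → ℝ) {N : ℕ} (w : (Fin N → O) → ℝ) (o : Fin N → O) :
    condSum (fun x => a * ξ x) N w o = a * condSum ξ N w o := by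
  induction N with
  | zero => simp [condSum]
  | succ N ih =>
    simp only [condSum, ih, mul_assoc, ← Finset.mul_sum, mul_div_assoc]
    ring

/-- `condSum` as a linear map in the observable. -/
def condSumₗ {N : ℕ} (w : (Fin N → O) → ℝ) (o : Fin N → O) : (O → ℝ) →ₗ[ℝ] ℝ where
  toFun ξ := condSum ξ N w o
  map_add' ξ ζ := condSum_add ξ ζ w o
  map_smul' a ξ := condSum_mul_left a ξ w o

/-- Positive weight of the string is essential: after a null history the quotient 0/0 is read as 0
and that round contributes nothing. -/
theorem condSum_const (a : ℝ) {N : ℕ} {w : (Fin N → O) → ℝ} (hw : ∀ o, 0 ≤ w o)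
    {o : Fin N → O} (ho : w o ≠ 0) : condSum (fun _ => a) N w o = a * N := by
  induction N with
  | zero => simp [condSum]
  | succ N ih =>
    have hT : ∑ x, ∑ o', w (Fin.cons x o') ≠ 0 := by
      rw [← sum_cons]
      exact (Finset.sum_pos' (fun o _ => hw o)
        ⟨o, Finset.mem_univ _, lt_of_le_of_ne (hw o) ho.symm⟩).ne'
    have h := ih (w := fun o' => w (Fin.cons (o 0) o')) (fun o' => hw _) (o := Fin.tail o)
      (by rwa [Fin.cons_self_tail])
    simp only [condSum, h, ← Finset.mul_sum]
    rw [mul_div_assoc, div_self hT]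
    push_cast
    ring

/-- Each round's numerator is the hypothesis at that round summed over all futures; the denominator
is nonnegative, and 0/0 = 0 makes null histories harmless. -/
theorem condSum_nonneg {ξ : O → ℝ} {N : ℕ} {w : (Fin N → O) → ℝ} (hw : ∀ o, 0 ≤ w o)
    (hξ : ∀ u o, 0 ≤ ∑ x, ξ x * w (Function.update o u x)) (o : Fin N → O) :
    0 ≤ condSum ξ N w o := by
  induction N with
  | zero => simp [condSum]
  | succ N ih =>
    refine add_nonneg (div_nonneg ?_ ?_) (ih (fun _ => hw _) (fun u o' => ?_) _)
    · simp only [Finset.mul_sum]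
      rw [Finset.sum_comm]
      refine Finset.sum_nonneg fun o' _ => ?_
      simpa using hξ 0 (Fin.cons (o 0) o')
    · exact Finset.sum_nonneg fun x _ => Finset.sum_nonneg fun o' _ => hw _
    · simpa [Fin.cons_update] using hξ u.succ (Fin.cons (o 0) o')

theorem condSum_mem_Icc {ξ : O → ℝ} (h0 : ∀ x, 0 ≤ ξ x) (h1 : ∀ x, ξ x ≤ 1) {N : ℕ}
    {w : (Fin N → O) → ℝ} (hw : ∀ o, 0 ≤ w o) (o : Fin N → O) :
    condSum ξ N w o ∈ Set.Icc 0 (N : ℝ) := by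
  induction N with
  | zero => simp [condSum]
  | succ N ih =>
    obtain ⟨i0, i1⟩ := ih (w := fun o' => w (Fin.cons (o 0) o')) (fun _ => hw _) (Fin.tail o)
    have hT : ∀ x, 0 ≤ ∑ o', w (Fin.cons x o') := fun x => Finset.sum_nonneg fun o' _ => hw _
    have j0 : 0 ≤ (∑ x, ξ x * ∑ o', w (Fin.cons x o')) / ∑ x, ∑ o', w (Fin.cons x o') :=
      div_nonneg (Finset.sum_nonneg fun x _ => mul_nonneg (h0 x) (hT x))
        (Finset.sum_nonneg fun x _ => hT x)
    have j1 : (∑ x, ξ x * ∑ o', w (Fin.cons x o')) / ∑ x, ∑ o', w (Fin.cons x o') ≤ 1 :=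
      div_le_one_of_le₀ (Finset.sum_le_sum fun x _ => mul_le_of_le_one_left (hT x) (h1 x))
        (Finset.sum_nonneg fun x _ => hT x)
    constructor
    · exact add_nonneg j0 i0
    · push_cast
      rw [add_comm (N : ℝ)]
      exact add_le_add j1 i1

/-- Supermartingale argument, by induction on the first round: conditionally on it, the remaining N
rounds contribute at most B^N. Unnormalized weights make conditioning a mere restriction of `w`. -/
theorem sum_mul_exp_condSum_le {ξ : O → ℝ} (h0 : ∀ x, 0 ≤ ξ x) (h1 : ∀ x, ξ x ≤ 1)
    {s c d B : ℝ} (hB0 : 0 ≤ B)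
    (hB : ∀ p, 0 ≤ p → p ≤ 1 → Real.exp (s * (p - d)) * (1 - p + p * Real.exp (-(s * c))) ≤ B)
    {N : ℕ} {w : (Fin N → O) → ℝ} (hw : ∀ o, 0 ≤ w o) :
    ∑ o, w o * Real.exp (s * (condSum ξ N w o - c * ∑ u, ξ (o u) - d * N)) ≤
      B ^ N * ∑ o, w o := by
  induction N with
  | zero => simp [condSum]
  | succ N ih =>
    have hT : ∀ x, 0 ≤ ∑ o', w (Fin.cons x o') := fun x => Finset.sum_nonneg fun o' _ => hw _
    set T : O → ℝ := fun x => ∑ o', w (Fin.cons x o') with hTdef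
    set p := (∑ x, ξ x * T x) / ∑ x, T x with hp
    have hTT : 0 ≤ ∑ x, T x := Finset.sum_nonneg fun x _ => hT x
    have hp0 : 0 ≤ p := div_nonneg (Finset.sum_nonneg fun x _ => mul_nonneg (h0 x) (hT x)) hTT
    have hp1 : p ≤ 1 :=
      div_le_one_of_le₀ (Finset.sum_le_sum fun x _ => mul_le_of_le_one_left (hT x) (h1 x)) hTT
    have hpT : p * ∑ x, T x = ∑ x, ξ x * T x := by
      rcases eq_or_ne (∑ x, T x) 0 with h | h
      · have hz : ∀ x, T x = 0 := fun x =>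
          (Finset.sum_eq_zero_iff_of_nonneg fun x _ => hT x).1 h x (Finset.mem_univ x)
        simp [hz]
      · exact div_mul_cancel₀ _ h
    -- Convexity of exp puts the graph below its chord on [0,1], reducing ξ to a Bernoulli variable
    -- of the same mean.
    have hexp : ∀ x, Real.exp (-(s * c) * ξ x) ≤ 1 - ξ x + ξ x * Real.exp (-(s * c)) := by
      intro x
      have := convexOn_exp.2 (Set.mem_univ 0) (Set.mem_univ (-(s * c)))
        (sub_nonneg.2 (h1 x)) (h0 x) (by ring)
      simpa [mul_comm] using this
    rw [sum_cons, sum_cons]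
    calc ∑ x, ∑ o', w (Fin.cons x o') * Real.exp (s * (condSum ξ (N + 1) w (Fin.cons x o')
            - c * ∑ u, ξ ((Fin.cons x o' : Fin (N + 1) → O) u) - d * ((N + 1 : ℕ) : ℝ)))
        = ∑ x, Real.exp (s * (p - d)) * Real.exp (-(s * c) * ξ x) *
            ∑ o', w (Fin.cons x o') * Real.exp (s * (condSum ξ N (fun o' => w (Fin.cons x o')) o'
              - c * ∑ u, ξ (o' u) - d * N)) := by
          refine Finset.sum_congr rfl fun x _ => ?_
          rw [Finset.mul_sum]
          refine Finset.sum_congr rfl fun o' _ => ?_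
          rw [mul_left_comm, ← Real.exp_add, ← Real.exp_add, Fin.sum_univ_succ]
          simp only [condSum, Fin.cons_zero, Fin.cons_succ, Fin.tail_cons]
          congr 2
          push_cast
          ring
      _ ≤ ∑ x, Real.exp (s * (p - d)) * (1 - ξ x + ξ x * Real.exp (-(s * c))) * (B ^ N * T x) := by
          refine Finset.sum_le_sum fun x _ => ?_
          have h := ih (w := fun o' => w (Fin.cons x o')) fun _ => hw _
          have hnn : 0 ≤ B ^ N * T x := mul_nonneg (pow_nonneg hB0 _) (hT x)
          refine (mul_le_mul_of_nonneg_left h (by positivity)).trans ?_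
          exact mul_le_mul_of_nonneg_right
            (mul_le_mul_of_nonneg_left (hexp x) (Real.exp_pos _).le) hnn
      _ = Real.exp (s * (p - d)) * (1 - p + p * Real.exp (-(s * c))) * (B ^ N * ∑ x, T x) := by
          have e : ∀ x, Real.exp (s * (p - d)) * (1 - ξ x + ξ x * Real.exp (-(s * c))) *
              (B ^ N * T x) = Real.exp (s * (p - d)) * B ^ N *
              (T x + (Real.exp (-(s * c)) - 1) * (ξ x * T x)) := fun x => by ring
          simp only [e]
          rw [← Finset.mul_sum, Finset.sum_add_distrib, ← Finset.mul_sum, ← hpT]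
          ring
      _ ≤ B * (B ^ N * ∑ x, T x) :=
          mul_le_mul_of_nonneg_right (hB p hp0 hp1) (mul_nonneg (pow_nonneg hB0 _) hTT)
      _ = B ^ (N + 1) * ∑ x, T x := by ring

open Classical in
/-- The weight of an event. -/
def weight {Ω : Type*} [Fintype Ω] (w : Ω → ℝ) (E : Set Ω) : ℝ := ∑ o with o ∈ E, w o

/-! ### Monotonicity and union bounds for weights of events -/

section Weight

variable {Ω : Type*} [Fintype Ω] {w : Ω → ℝ}

/-- Inclusion is required only on strings of nonzero weight, where identities such as
`condSum_const` are available. -/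
theorem weight_mono (hw : ∀ o, 0 ≤ w o) {E F : Set Ω} (h : ∀ o, w o ≠ 0 → o ∈ E → o ∈ F) :
    weight w E ≤ weight w F := by
  classical
  simp only [weight, Finset.sum_filter]
  refine Finset.sum_le_sum fun o _ => ?_
  by_cases h0 : w o = 0
  · simp [h0]
  · by_cases hE : o ∈ E
    · simp [hE, h o h0 hE]
    · simp only [hE, if_false]
      split_ifs
      exacts [hw o, le_rfl]

theorem weight_nonneg (hw : ∀ o, 0 ≤ w o) (E : Set Ω) : 0 ≤ weight w E :=
  Finset.sum_nonneg fun o _ => hw o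

theorem weight_le_sum (hw : ∀ o, 0 ≤ w o) (E : Set Ω) : weight w E ≤ ∑ o, w o := by
  classical
  exact Finset.sum_le_sum_of_subset_of_nonneg (Finset.filter_subset _ _) fun o _ _ => hw o

theorem weight_eq_zero {E : Set Ω} (h : ∀ o ∈ E, w o = 0) : weight w E = 0 := by
  classical
  exact Finset.sum_eq_zero fun o ho => h o (Finset.mem_filter.1 ho).2

theorem weight_union_le (hw : ∀ o, 0 ≤ w o) (E F : Set Ω) :
    weight w (E ∪ F) ≤ weight w E + weight w F := by
  classical
  simp only [weight, Finset.sum_filter, ← Finset.sum_add_distrib]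
  refine Finset.sum_le_sum fun o _ => ?_
  by_cases hE : o ∈ E <;> by_cases hF : o ∈ F <;> simp [hE, hF, hw o]

theorem weight_iUnion_le (hw : ∀ o, 0 ≤ w o) {I : Type*} [Fintype I] (E : I → Set Ω) :
    weight w (⋃ i, E i) ≤ ∑ i, weight w (E i) := by
  classical
  simp only [weight, Finset.sum_filter]
  rw [Finset.sum_comm]
  refine Finset.sum_le_sum fun o _ => ?_
  have hnn : ∀ i ∈ Finset.univ, 0 ≤ if o ∈ E i then w o else 0 := fun i _ => by
    split_ifs
    exacts [hw o, le_rfl]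
  split_ifs with h
  · obtain ⟨i, hi⟩ := Set.mem_iUnion.1 h
    simpa [hi] using Finset.single_le_sum hnn (Finset.mem_univ i)
  · exact Finset.sum_nonneg hnn

end Weight

/-- The coefficient of log ε is a perfect square: 16a² + 24a√N + 9N = (4a + 3√N)². -/
theorem bU_eq {N : ℝ} (hN : 0 < N) (a ε : ℝ) :
    bU N a ε = √(a ^ 2 + -Real.log ε / 2 * (1 + 4 * (a / √N) / 3) ^ 2) := by
  have hs : √N ^ 2 = N := Real.sq_sqrt hN.le
  have hs0 : √N ≠ 0 := (Real.sqrt_pos.2 hN).ne'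
  have h : (3 * √(2 * N)) = √(18 * N) := by
    rw [show 18 * N = 3 ^ 2 * (2 * N) by ring, Real.sqrt_mul (by norm_num) (2 * N),
      Real.sqrt_sq (by norm_num)]
  rw [bU, h, ← Real.sqrt_div' _ (by positivity)]
  congr 1
  field_simp
  rw [hs]
  ring_nf
  rw [hs]
  ring

/-- Kato's inequality for variables with values in `[0, 1]`. -/
theorem weight_deviation_lt_condSum_sub_sum_le {ξ : O → ℝ} (h0 : ∀ x, 0 ≤ ξ x)
    (h1 : ∀ x, ξ x ≤ 1) {N : ℕ} (hN : 0 < N) {w : (Fin N → O) → ℝ} (hw : ∀ o, 0 ≤ w o)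
    (hw1 : ∑ o, w o = 1) {ε : ℝ} (hε : 0 < ε) (hε1 : ε < 1) (a : ℝ) :
    weight w {o | deviation N a (bU N a ε) (∑ u, ξ (o u)) <
      condSum ξ N w o - ∑ u, ξ (o u)} ≤ ε := by
  have hN' : (0 : ℝ) < N := Nat.cast_pos.2 hN
  have hlog : Real.log ε < 0 := Real.log_neg hε hε1
  set α := a / √(N : ℝ) with hα
  set b := bU N a ε with hb
  set β := b / √(N : ℝ) with hβ
  have hs : √(N : ℝ) ^ 2 = N := Real.sq_sqrt hN'.le
  have hs0 : 0 < √(N : ℝ) := Real.sqrt_pos.2 hN'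
  have hb0 : 0 ≤ b := by rw [hb, bU_eq hN']; positivity
  have hb2 : b ^ 2 = a ^ 2 + -Real.log ε / 2 * (1 + 4 * α / 3) ^ 2 := by
    rw [hb, bU_eq hN', Real.sq_sqrt]
    have : 0 ≤ -Real.log ε := by linarith
    positivity
  have hβ0 : 0 ≤ β := div_nonneg hb0 hs0.le
  have hβ2 : (β ^ 2 - α ^ 2) * N = -Real.log ε / 2 * (1 + 4 * α / 3) ^ 2 := by
    rw [hβ, hα, div_pow, div_pow, hs, ← sub_div, div_mul_cancel₀ _ hN'.ne', hb2]
    ring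
  have hβα : α ^ 2 ≤ β ^ 2 := by
    have : 0 ≤ (β ^ 2 - α ^ 2) * N := by
      rw [hβ2]
      have : 0 ≤ -Real.log ε := by linarith
      positivity
    have := nonneg_of_mul_nonneg_left this hN'
    linarith
  have habs : |α| ≤ β := abs_le_of_sq_le_sq hβα hβ0
  have hαβ := abs_le.1 habs
  -- With α = a/√N, β = b/√N, moving the count-dependent part of the deviation to the other side
  -- gives the tilt lemma's form with c = 1 + 2α and d = β - α.
  have hev : ∀ o : Fin N → O, deviation N a b (∑ u, ξ (o u)) <
      condSum ξ N w o - ∑ u, ξ (o u) →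
      (β - α) * N < condSum ξ N w o - (1 + 2 * α) * ∑ u, ξ (o u) := by
    intro o ho
    have e : deviation N a b (∑ u, ξ (o u)) = (β - α) * N + 2 * α * ∑ u, ξ (o u) := by
      have ha : a = α * √(N : ℝ) := (div_mul_cancel₀ _ hs0.ne').symm
      have hbb : b = β * √(N : ℝ) := (div_mul_cancel₀ _ hs0.ne').symm
      rw [deviation, ha, hbb]
      field_simp
      rw [hs]
      ring
    rw [e] at ho
    linarith
  have hΛ0 : ∀ o : Fin N → O, 0 ≤ ∑ u, ξ (o u) := fun o => Finset.sum_nonneg fun u _ => h0 _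
  have hΛ1 : ∀ o : Fin N → O, ∑ u, ξ (o u) ≤ N := fun o => by
    simpa using Finset.sum_le_sum fun (u : Fin N) (_ : u ∈ Finset.univ) => h1 (o u)
  -- Outside the range of the tilt lemma (c ≤ 0 or d ≥ 1) the event is empty, since the count and
  -- the conditional sum lie in [0, N] and |α| ≤ β.
  rcases le_or_gt (1 + 2 * α) 0 with hc | hc
  · refine (weight_eq_zero fun o ho => ?_).trans_le hε.le
    have h2 := hev o ho
    have h3 := (condSum_mem_Icc h0 h1 hw o).2
    have := hΛ0 o; have := hΛ1 o
    exfalso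
    nlinarith
  rcases le_or_gt 1 (β - α) with hd | hd
  · refine (weight_eq_zero fun o ho => ?_).trans_le hε.le
    have h2 := hev o ho
    have h3 := (condSum_mem_Icc h0 h1 hw o).2
    have := hΛ0 o
    exfalso
    nlinarith
  have hpos : 0 < β ^ 2 - α ^ 2 := by
    have h4 : 0 < (β ^ 2 - α ^ 2) * N := by
      rw [hβ2]
      exact mul_pos (by linarith) (pow_pos (by linarith) 2)
    exact pos_of_mul_pos_left h4 hN'.le
  have hlt : |α| < β := abs_lt_of_sq_lt_sq (by linarith) hβ0
  obtain ⟨hl1, hl2⟩ := abs_lt.1 hlt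
  obtain ⟨s, hs, hB⟩ := exists_exponential_tilt hc (d := β - α) (by linarith) hd (by linarith)
  set B := Real.exp (-(18 * (β - α) * (β - α + (1 + 2 * α) - 1) / (1 + 2 * (1 + 2 * α)) ^ 2))
    with hBdef
  -- The calibration of b: since d(d + c - 1) = β² - α² and 1 + 2c = 3 + 4α, `hβ2` makes the N-round
  -- exponent exactly log ε.
  have hBN : B ^ N = ε := by
    rw [hBdef, ← Real.exp_nat_mul]
    have h5 : (N : ℝ) * -(18 * (β - α) * (β - α + (1 + 2 * α) - 1) / (1 + 2 * (1 + 2 * α)) ^ 2)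
        = Real.log ε := by
      have h6 : 1 + 2 * (1 + 2 * α) ≠ 0 := by linarith
      have h7 : 18 * (β - α) * (β - α + (1 + 2 * α) - 1) * N =
          -Real.log ε * (1 + 2 * (1 + 2 * α)) ^ 2 := by
        linear_combination 18 * hβ2
      rw [mul_neg, mul_div_assoc', mul_comm (N : ℝ), h7, mul_div_cancel_right₀ _ (by positivity),
        neg_neg]
    rw [h5, Real.exp_log hε]
  have hmain := sum_mul_exp_condSum_le h0 h1 (Real.exp_pos _).le hB hw
  rw [hw1, mul_one, hBN] at hmain
  refine le_trans ?_ hmain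
  rw [weight, Finset.sum_filter]
  refine Finset.sum_le_sum fun o _ => ?_
  split_ifs with ho
  · refine le_mul_of_one_le_right (hw o) (Real.one_le_exp ?_)
    have := hev o ho
    exact mul_nonneg hs.le (by linarith)
  · exact mul_nonneg (hw o) (Real.exp_pos _).le

/-- The deviation for a variable with values in `[xmin, xmax]`. -/
def scaledDeviation (N a b xmin xmax S : ℝ) : ℝ :=
  (xmax - xmin) * deviation N a b (normalize N xmin xmax S)

/-- Kato's upper bound on the sum of conditional expectations. -/
theorem weight_add_scaledDeviation_lt_condSum_le {χ : O → ℝ} {xmin xmax : ℝ}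
    (h0 : ∀ x, xmin ≤ χ x) (h1 : ∀ x, χ x ≤ xmax) {N : ℕ} (hN : 0 < N)
    {w : (Fin N → O) → ℝ} (hw : ∀ o, 0 ≤ w o) (hw1 : ∑ o, w o = 1) {ε : ℝ} (hε : 0 < ε)
    (hε1 : ε < 1) (a : ℝ) :
    weight w {o | ∑ u, χ (o u) + scaledDeviation N a (bU N a ε) xmin xmax (∑ u, χ (o u)) <
      condSum χ N w o} ≤ ε := by
  have hO : Nonempty O := by
    by_contra h
    rw [not_nonempty_iff] at h
    have : IsEmpty (Fin N → O) := ⟨fun o => h.elim (o ⟨0, hN⟩)⟩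
    simp at hw1
  have hle : xmin ≤ xmax := (h0 hO.some).trans (h1 _)
  rcases hle.eq_or_lt with h | h
  -- Degenerate range: χ is constant, so on strings of nonzero weight its conditional sum equals its
  -- observed sum.
  · subst h
    refine (weight_eq_zero fun o ho => ?_).trans_le hε.le
    by_contra hne
    have hχ : χ = fun _ => xmin := funext fun x => le_antisymm (h1 x) (h0 x)
    simp only [Set.mem_ofPred_eq, scaledDeviation, sub_self, zero_mul, add_zero] at ho
    rw [hχ, condSum_const xmin hw hne] at ho
    simp [mul_comm] at ho
  · have hR : 0 < xmax - xmin := sub_pos.2 h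
    set ξ : O → ℝ := fun x => (χ x - xmin) / (xmax - xmin) with hξ
    refine le_trans (weight_mono hw fun o hne ho => ?_)
      (weight_deviation_lt_condSum_sub_sum_le (ξ := ξ)
        (fun x => div_nonneg (sub_nonneg.2 (h0 x)) hR.le)
        (fun x => div_le_one_of_le₀ (by linarith [h1 x]) hR.le) hN hw hw1 hε hε1 a)
    have e1 : ∑ u, ξ (o u) = normalize N xmin xmax (∑ u, χ (o u)) := by
      simp only [hξ, normalize]
      rw [← Finset.sum_div, Finset.sum_sub_distrib]
      simp
    have e2 : condSum χ N w o = (xmax - xmin) * condSum ξ N w o + xmin * N := by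
      rw [← condSum_const xmin hw hne, ← condSum_mul_left, ← condSum_add]
      congr 1
      funext x
      simp only [hξ]
      field_simp
      ring
    have e3 : ∑ u, χ (o u) = (xmax - xmin) * ∑ u, ξ (o u) + xmin * N := by
      rw [e1, normalize]
      field_simp
      ring
    simp only [Set.mem_ofPred_eq, scaledDeviation] at ho ⊢
    rw [← e1, e2] at ho
    rw [← mul_lt_mul_iff_right₀ hR]
    linarith

/-- Lets the lower bound follow from the upper one by reflecting the variable and the sign of a. -/
theorem bL_eq (N a ε : ℝ) : bL N a ε = bU N (-a) ε := by
  simp only [bL, bU]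
  ring_nf

/-- Kato's lower bound on the sum of conditional expectations. -/
theorem weight_condSum_lt_sub_scaledDeviation_le {χ : O → ℝ} {xmin xmax : ℝ}
    (h0 : ∀ x, xmin ≤ χ x) (h1 : ∀ x, χ x ≤ xmax) {N : ℕ} (hN : 0 < N)
    {w : (Fin N → O) → ℝ} (hw : ∀ o, 0 ≤ w o) (hw1 : ∑ o, w o = 1) {ε : ℝ} (hε : 0 < ε)
    (hε1 : ε < 1) (a : ℝ) :
    weight w {o | condSum χ N w o <
      ∑ u, χ (o u) - scaledDeviation N a (bL N a ε) xmin xmax (∑ u, χ (o u))} ≤ ε := by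
  have hN' : (N : ℝ) ≠ 0 := Nat.cast_ne_zero.2 hN.ne'
  -- Apply the upper bound to -χ with parameter -a: reflection sends n to N - n, so a(2n/N - 1) is
  -- unchanged.
  refine le_trans (weight_mono hw fun o _ ho => ?_)
    (weight_add_scaledDeviation_lt_condSum_le (χ := fun x => -1 * χ x) (xmin := -xmax)
      (xmax := -xmin) (fun x => by linarith [h1 x]) (fun x => by linarith [h0 x]) hN hw hw1 hε hε1
      (-a))
  simp only [Set.mem_ofPred_eq] at ho ⊢
  rw [condSum_mul_left, ← Finset.mul_sum, ← bL_eq]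
  have e : scaledDeviation N (-a) (bL N a ε) (-xmax) (-xmin) (-1 * ∑ u, χ (o u)) =
      scaledDeviation N a (bL N a ε) xmin xmax (∑ u, χ (o u)) := by
    have hsub : -xmin - -xmax = xmax - xmin := by ring
    rw [scaledDeviation, scaledDeviation, hsub]
    rcases eq_or_ne (xmax - xmin) 0 with h | h
    · simp [h]
    · simp only [deviation, normalize, hsub]
      field_simp
      ring
  rw [e]
  linarith

end FiniteProcess

/-! ### Single-round operators of the protocol -/

theorem ofReal_smul_nonneg {ι : Type*} {r : ℝ} (hr : 0 ≤ r) {T : Op ι} (hT : 0 ≤ T) :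
    0 ≤ ((r : ℝ) : ℂ) • T := by
  rw [ContinuousLinearMap.nonneg_iff_isPositive] at hT ⊢
  exact hT.smul_of_nonneg (by exact_mod_cast hr)

theorem ketbra_nonneg {ι : Type*} (v : Ell ι) : 0 ≤ ketbra v := by
  rw [ContinuousLinearMap.nonneg_iff_isPositive]
  exact InnerProductSpace.isPositive_rankOne_self v

theorem ketbra_smul {ι : Type*} (c : ℝ) (v : Ell ι) :
    ketbra ((c : ℂ) • v) = ((c ^ 2 : ℝ) : ℂ) • ketbra v := by
  ext1 ψ
  simp only [ketbra, InnerProductSpace.rankOne_apply, inner_smul_left, Complex.conj_ofReal,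
    smul_apply, smul_smul]
  push_cast
  ring_nf

theorem ketbra_add_add_ketbra_sub {ι : Type*} (v v' : Ell ι) :
    ketbra (v + v') + ketbra (v - v') = (2 : ℂ) • (ketbra v + ketbra v') := by
  ext1 ψ
  simp only [ketbra, InnerProductSpace.rankOne_apply, inner_add_left, inner_sub_left,
    smul_apply, add_apply]
  module

/-- Both pairs resolve the projection onto the same qubit subspace. -/
theorem ketbra_ketX_zero_add_one {nA : ℕ} :
    ketbra (ketX (nA := nA) 0) + ketbra (ketX 1) = ketbra (ket 0) + ketbra (ket 1) := by
  have h : ((1 / √2 : ℝ)) ^ 2 = 1 / 2 := by rw [div_pow, Real.sq_sqrt (by norm_num)]; norm_num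
  simp only [ketX, if_true, one_ne_zero, if_false]
  rw [ketbra_smul, ketbra_smul, ← smul_add, ketbra_add_add_ketbra_sub, smul_smul, h]
  norm_num

theorem sum_ketbra_ket {ι : Type*} [Fintype ι] [DecidableEq ι] :
    ∑ i : ι, ketbra (ket i) = (1 : Op ι) := by
  ext1 ψ
  have h := (hasSum_fintype _).unique (lp.hasSum_single (p := 2) (by simp) ψ)
  change _ = ψ
  conv_rhs => rw [← h]
  rw [sum_apply]
  refine Finset.sum_congr rfl fun i _ => ?_
  rw [ketbra, InnerProductSpace.rankOne_apply, ket, lp.inner_single_left, ← lp.single_smul]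
  simp

theorem sum_outcome {nA nM : ℕ} {M : Type*} [AddCommMonoid M] (f : Outcome nA nM → M) :
    ∑ o, f o = ∑ i, ∑ b, f (.key i b) + (∑ t, f (.test t) + ∑ k, f (.lwm k)) := by
  rw [← (outcomeEquiv nA nM).sum_comp f, Fintype.sum_sum_type, Fintype.sum_sum_type,
    Fintype.sum_prod_type]
  rfl

theorem sum_isKey {nA nM : ℕ} {M : Type*} [AddCommMonoid M]
    (f : Fin (nA + 2) × Basis nM × Bit → M) :
    ∑ t : {t : Fin (nA + 2) × Basis nM × Bit // IsKey t}, f t =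
      (f (0, 0, some 0) + f (0, 0, some 1)) + (f (1, 0, some 0) + f (1, 0, some 1)) := by
  let φ : Fin 2 × Fin 2 → Fin (nA + 2) × Basis nM × Bit :=
    fun x => (if x.1 = 0 then 0 else 1, 0, some x.2)
  have hφ : Function.Injective φ := by
    rintro ⟨i, b⟩ ⟨i', b'⟩ h
    simp only [φ, Prod.mk.injEq, Option.some.injEq, true_and] at h
    obtain ⟨h1, rfl⟩ := h
    fin_cases i <;> fin_cases i' <;> simp_all
  have himg : (Finset.univ.filter fun t => IsKey t) = Finset.univ.image φ := by
    ext ⟨i, β, b⟩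
    simp only [Finset.mem_filter, Finset.mem_univ, true_and, Finset.mem_image, φ,
      Prod.exists, Prod.mk.injEq]
    unfold IsKey
    dsimp only
    constructor
    · rintro ⟨rfl, hi, hb⟩
      obtain ⟨b, rfl⟩ := Option.ne_none_iff_exists'.1 hb
      rcases hi with rfl | rfl
      · exact ⟨0, b, by simp, rfl, rfl⟩
      · exact ⟨1, b, by simp, rfl, rfl⟩
    · rintro ⟨x, y, rfl, rfl, rfl⟩
      refine ⟨rfl, ?_, by simp⟩
      split_ifs
      exacts [Or.inl rfl, Or.inr rfl]
  rw [← Finset.sum_subtype (Finset.univ.filter fun t => IsKey t) (by simp) f, himg,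
    Finset.sum_image fun x _ y _ h => hφ h, Fintype.sum_prod_type]
  simp [Fin.sum_univ_two, φ]

namespace VEP

variable {nA nM nQ : ℕ} {κ : Type*} (P : VEP nA nM nQ κ)

/-- Virtual and actual key measurements have the same total effect: the non-detection effects agree,
so Bob's detection effects have equal sums, and so do Alice's projectors. This is why coefficients
constant on 𝒦 survive the virtual replacement. -/
theorem sum_V : ∑ i, ∑ b, P.V i b =
    ∑ t : {t : Fin (nA + 2) × Basis nM × Bit // IsKey t}, P.S t.1.1 t.1.2.1 t.1.2.2 := by
  rw [sum_isKey fun t => P.S t.1 t.2.1 t.2.2]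
  have h0 : (P.Γ 0).effect none + ((P.Γ 0).effect (some 0) + (P.Γ 0).effect (some 1)) = 1 := by
    rw [← (P.Γ 0).sum_effect, Fintype.sum_option, Fin.sum_univ_two]
  have hV : P.ΓV.effect none + (P.ΓV.effect (some 0) + P.ΓV.effect (some 1)) = 1 := by
    rw [← P.ΓV.sum_effect, Fintype.sum_option, Fin.sum_univ_two]
  have he : P.ΓV.effect (some 0) + P.ΓV.effect (some 1) =
      (P.Γ 0).effect (some 0) + (P.Γ 0).effect (some 1) := by
    rw [← P.ΓV_none] at h0
    exact add_left_cancel (hV.trans h0.symm)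
  simp only [Fin.sum_univ_two, V, S, ← smul_add, ← tensorOpₗ_apply, ← map_add, he,
    ← LinearMap.add_apply, ketbra_ketX_zero_add_one]

theorem sum_eigvec : ∑ k, ketbra (P.eigvec k) = 1 := P.eigvec.sum_rankOne_eq_id

/-- The operator of an observable which on the non-local rounds depends on `(i, β, b)` only and is
constant on the key rounds. -/
theorem sum_smul_effect (f : Outcome nA nM → ℝ) (c : Fin (nA + 2) × Basis nM × Bit → ℝ) (cK : ℝ)
    (hkey : ∀ i b, f (.key i b) = cK) (hc : ∀ t, IsKey t → c t = cK)
    (htest : ∀ t, f (.test t) = c t.1) :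
    ∑ o, ((f o : ℝ) : ℂ) • P.effect o =
      ((1 - P.α : ℝ) : ℂ) • ∑ i, ∑ β, ∑ b, ((c (i, β, b) : ℝ) : ℂ) • P.S i β b +
      ((P.α : ℝ) : ℂ) • ∑ k, ((f (.lwm k) : ℝ) : ℂ) • opA (ketbra (P.eigvec k)) := by
  rw [sum_outcome, ← add_assoc]
  simp only [effect, hkey, htest, smul_comm _ ((1 - P.α : ℝ) : ℂ), smul_comm _ ((P.α : ℝ) : ℂ),
    ← Finset.smul_sum, ← smul_add]
  congr 2
  rw [P.sum_V, Finset.smul_sum]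
  have h : ∑ i, ∑ β, ∑ b, ((c (i, β, b) : ℝ) : ℂ) • P.S i β b =
      ∑ t : Fin (nA + 2) × Basis nM × Bit, ((c t : ℝ) : ℂ) • P.S t.1 t.2.1 t.2.2 := by
    simp only [Fintype.sum_prod_type]
  rw [h, ← Fintype.sum_subtype_add_sum_subtype IsKey]
  congr 1
  exact Finset.sum_congr rfl fun t _ => by rw [hc t.1 t.2]

theorem sum_effect : ∑ o, P.effect o = 1 := by
  have h := P.sum_smul_effect (fun _ => 1) (fun _ => 1) 1 (fun _ _ => rfl) (fun _ _ => rfl)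
    fun _ => rfl
  simp only [Complex.ofReal_one, one_smul] at h
  rw [h]
  have hA : ∑ k, opA (ketbra (P.eigvec k)) = (1 : Op (Fin (nA + 2) × κ)) := by
    simp only [opA, ← onFactorₗ_apply, ← map_sum, sum_eigvec]
    simp
  have hS : ∑ i, ∑ β, ∑ b, P.S i β b = 1 := by
    simp only [S, ← Finset.smul_sum, ← tensorOpₗ_apply, ← map_sum, (P.Γ _).sum_effect]
    simp only [← Finset.sum_smul, ← LinearMap.sum_apply, ← map_sum, ← Complex.ofReal_sum, P.sum_pB,
      sum_ketbra_ket, ← Finset.smul_sum]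
    simp [tensorOpₗ_apply, tensorOp_one, opA]
  rw [hA, hS, ← add_smul, ← Complex.ofReal_add]
  simp

/-- The division by p_β in χ_{Q,l} cancels the basis probability carried by S. -/
theorem sum_chiQ_smul_effect (l : Fin nQ) :
    ∑ o, ((P.chiQ l o : ℝ) : ℂ) • P.effect o = ((1 - P.α : ℝ) : ℂ) • P.Q l := by
  rw [P.sum_smul_effect (P.chiQ l) (fun t => P.c l t.1 t.2.1 t.2.2 / P.pB t.2.1)
    (P.c l 0 0 (some 0) / P.pB 0) (fun _ _ => rfl) ?_ fun _ => rfl]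
  · simp only [chiQ, Complex.ofReal_zero, zero_smul, Finset.sum_const_zero, smul_zero, add_zero]
    simp only [S, Q, smul_smul, ← Complex.ofReal_mul, div_mul_cancel₀ _ (P.pB_pos _).ne']
  · rintro ⟨i, β, b⟩ ⟨h1, h2⟩
    obtain rfl : β = 0 := h1
    dsimp only
    rw [P.c_key l i b 0 (some 0) ⟨rfl, h2⟩ ⟨rfl, Or.inl rfl, by simp⟩]

theorem sum_chiW_smul_effect :
    ∑ o, ((P.chiW o : ℝ) : ℂ) • P.effect o = ((P.α : ℝ) : ℂ) • opA P.W := by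
  rw [P.sum_smul_effect P.chiW (fun _ => 0) 0 (fun _ _ => rfl) (fun _ _ => rfl) fun _ => rfl]
  simp only [Complex.ofReal_zero, zero_smul, Finset.sum_const_zero, smul_zero, zero_add, chiW, W,
    opA, ← onFactorₗ_apply, map_sum, map_smul]

theorem sum_chiPh_smul_effect :
    ∑ o, ((chiPh o : ℝ) : ℂ) • P.effect o = ((1 - P.α : ℝ) : ℂ) • P.Eph := by
  rw [sum_outcome]
  simp only [chiPh, effect, Eph, Fin.sum_univ_two, Complex.ofReal_zero, zero_smul,
    Finset.sum_const_zero, add_zero]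
  simp only [ne_eq, not_true_eq_false, if_false, zero_ne_one, one_ne_zero, not_false_eq_true,
    if_true, Complex.ofReal_zero, Complex.ofReal_one, zero_smul, one_smul, zero_add, add_zero,
    smul_add]

theorem V_nonneg (i b : Fin 2) : 0 ≤ P.V i b :=
  ofReal_smul_nonneg (P.pB_pos 0).le (tensorOp_nonneg (ketbra_nonneg _) (P.ΓV.effect_nonneg _))

theorem S_nonneg (i : Fin (nA + 2)) (β : Basis nM) (b : Bit) : 0 ≤ P.S i β b :=
  ofReal_smul_nonneg (P.pB_pos β).le (tensorOp_nonneg (ketbra_nonneg _) ((P.Γ β).effect_nonneg _))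

theorem effect_nonneg (o : Outcome nA nM) : 0 ≤ P.effect o := by
  have hα : 0 ≤ 1 - P.α := sub_nonneg.2 P.α_le_one
  cases o with
  | key i b => exact ofReal_smul_nonneg hα (P.V_nonneg i b)
  | test t => exact ofReal_smul_nonneg hα (P.S_nonneg _ _ _)
  | lwm k => exact ofReal_smul_nonneg P.α_pos.le (opA_nonneg (ketbra_nonneg _))

/-! ### Outcome statistics -/

variable {N : ℕ} (ρ : DensityOperator (Fin N → Fin (nA + 2) × κ))

theorem outcomeProb_nonneg (o : Fin N → Outcome nA nM) : 0 ≤ P.outcomeProb ρ o :=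
  ρ.expect_nonneg (tensorPow_nonneg fun _ => P.effect_nonneg _)

/-- By multilinearity the tensor powers of effects sum to the tensor power of the sum of effects,
which is the identity. -/
theorem sum_outcomeProb : ∑ o, P.outcomeProb ρ o = 1 := by
  simp only [outcomeProb, ← ρ.expectₗ_apply, ← map_sum, ← tensorPowₘ_apply]
  have h := (tensorPowₘ (N := N)).map_sum (fun _ : Fin N => P.effect)
  rw [← h, tensorPowₘ_apply]
  simp only [P.sum_effect, tensorPow_one]
  exact ρ.expect_one

/-- Multilinearity in slot u collects the sum into one tensor power with the averaged operator in
that slot and effects elsewhere; all factors are positive. -/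
theorem sum_mul_outcomeProb_update_nonneg {f : Outcome nA nM → ℝ}
    (hf : 0 ≤ ∑ x, ((f x : ℝ) : ℂ) • P.effect x) (u : Fin N) (o : Fin N → Outcome nA nM) :
    0 ≤ ∑ x, f x * P.outcomeProb ρ (Function.update o u x) := by
  have hupd : ∀ x, (fun v => P.effect (Function.update o u x v)) =
      Function.update (fun v => P.effect (o v)) u (P.effect x) := fun x => by
    funext v
    rcases eq_or_ne v u with rfl | h
    · simp
    · simp [Function.update_of_ne h]
  have h : ∑ x, f x * P.outcomeProb ρ (Function.update o u x) =
      ρ.expect (tensorPow (Function.update (fun v => P.effect (o v)) u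
        (∑ x, ((f x : ℝ) : ℂ) • P.effect x))) := by
    rw [← tensorPowₘ_apply, MultilinearMap.map_update_sum, ← ρ.expectₗ_apply, map_sum]
    refine Finset.sum_congr rfl fun x _ => ?_
    rw [outcomeProb, hupd, ← tensorPowₘ_apply, MultilinearMap.map_update_smul, Complex.coe_smul,
      map_smul, smul_eq_mul, ρ.expectₗ_apply]
  rw [h]
  refine ρ.expect_nonneg (tensorPow_nonneg fun v => ?_)
  rcases eq_or_ne v u with rfl | hv
  · simpa using hf
  · simpa [Function.update_of_ne hv] using P.effect_nonneg _

/-- The operator inequality bounds the conditional phase-error rates. -/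
theorem condSum_chiPh_le (η : Fin nQ → ℝ)
    (hop : P.Eph ≤ ∑ l, ((η l : ℝ) : ℂ) • P.Q l + opA P.W) (o : Fin N → Outcome nA nM) :
    condSum chiPh N (P.outcomeProb ρ) o ≤
      ∑ l, η l * condSum (P.chiQ l) N (P.outcomeProb ρ) o +
        (1 - P.α) / P.α * condSum P.chiW N (P.outcomeProb ρ) o := by
  -- The factor (1-α)/α compensates for W being measured with probability α, so that the operator of
  -- `f` is (1-α) times the gap in `hop`.
  set f : Outcome nA nM → ℝ :=
    ∑ l, η l • P.chiQ l + ((1 - P.α) / P.α) • P.chiW - chiPh with hf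
  have h0 : 0 ≤ ∑ x, ((f x : ℝ) : ℂ) • P.effect x := by
    have e : ∑ x, ((f x : ℝ) : ℂ) • P.effect x =
        ((1 - P.α : ℝ) : ℂ) • (∑ l, ((η l : ℝ) : ℂ) • P.Q l + opA P.W - P.Eph) := by
      have e1 : ∀ x, ((f x : ℝ) : ℂ) • P.effect x =
          ∑ l, ((η l : ℝ) : ℂ) • ((P.chiQ l x : ℝ) : ℂ) • P.effect x +
            (((1 - P.α) / P.α : ℝ) : ℂ) • ((P.chiW x : ℝ) : ℂ) • P.effect x -
            ((chiPh x : ℝ) : ℂ) • P.effect x := fun x => by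
        simp only [smul_smul, ← Finset.sum_smul, ← add_smul, ← sub_smul]
        congr 1
        simp [hf, Finset.sum_apply]
      simp only [e1]
      rw [Finset.sum_sub_distrib, Finset.sum_add_distrib, Finset.sum_comm]
      simp only [← Finset.smul_sum]
      rw [P.sum_chiW_smul_effect, P.sum_chiPh_smul_effect, smul_smul, ← Complex.ofReal_mul,
        div_mul_cancel₀ _ P.α_pos.ne', smul_sub, smul_add, Finset.smul_sum]
      simp only [P.sum_chiQ_smul_effect, smul_comm _ ((1 - P.α : ℝ) : ℂ)]
    rw [e]
    exact ofReal_smul_nonneg (sub_nonneg.2 P.α_le_one) (sub_nonneg.2 hop)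
  have h1 : 0 ≤ condSumₗ (P.outcomeProb ρ) o f :=
    condSum_nonneg (P.outcomeProb_nonneg ρ) (P.sum_mul_outcomeProb_update_nonneg ρ h0) o
  rw [hf, map_sub, map_add, map_sum] at h1
  simp only [map_smul, smul_eq_mul] at h1
  exact sub_nonneg.1 h1

end VEP

/-! ### Monotonicity of the clamped Kato bound and the final union bound -/

theorem minVal_le {nA nM : ℕ} (χ : Outcome nA nM → ℝ) (o : Outcome nA nM) : minVal χ ≤ χ o :=
  ciInf_le (Set.finite_range χ).bddBelow o

theorem le_maxVal {nA nM : ℕ} (χ : Outcome nA nM → ℝ) (o : Outcome nA nM) : χ o ≤ maxVal χ :=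
  le_ciSup (Set.finite_range χ).bddAbove o

/-- The function is affine in S with slope 1 + 2a/√N, and clamping a at -√N/2 makes this
nonnegative. It allows M_W to be replaced by its upper bound. -/
theorem KPlusMono_mono {N : ℝ} (hN : 0 < N) (ε g : ℝ) {xmin xmax : ℝ} (hx : xmin ≤ xmax) :
    Monotone (KPlusMono ε N xmin xmax g) := by
  intro S T hST
  rcases hx.eq_or_lt with h | h
  · simpa [KPlusMono, h] using hST
  have hR : 0 < xmax - xmin := sub_pos.2 h
  have hs : √N ^ 2 = N := Real.sq_sqrt hN.le
  have hs0 : 0 < √N := Real.sqrt_pos.2 hN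
  simp only [KPlusMono]
  have ha := le_max_left (-√N / 2) (aU N g ε)
  set a := max (-√N / 2) (aU N g ε)
  have e : ∀ S, S + (xmax - xmin) * deviation N a (bU N a ε) (normalize N xmin xmax S) =
      S * (1 + 2 * a / √N) +
        ((xmax - xmin) * (bU N a ε - a) * √N - 2 * a * xmin * √N) := fun S => by
    rw [deviation, normalize]
    field_simp
    ring_nf
    rw [hs]
    ring
  rw [e, e]
  have : 0 ≤ 1 + 2 * a / √N := by
    rw [one_add_div hs0.ne']
    exact div_nonneg (by linarith) hs0.le
  gcongr

end QKD

end

theorem mainTheorem3 {nA nM nQ N : ℕ} {κ : Type*} (hN : 0 < N) (P : QKD.VEP nA nM nQ κ)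
    (ρ : QKD.DensityOperator (Fin N → Fin (nA + 2) × κ))
    (η : Fin nQ → ℝ)
    (hop : P.Eph ≤ ∑ l, ((η l : ℝ) : ℂ) • P.Q l + QKD.opA P.W)
    (MWU εB : ℝ)
    (hB : P.prob ρ {o | P.MW o > MWU} ≤ εB)
    (εK : ℝ) (ε : Fin nQ → ℝ) (hεK : 0 < εK) (hε : ∀ l, 0 < ε l) (hsum : ∑ l, ε l = εK)
    (gQ : Fin nQ → ℝ) (gW gph : ℝ)
    (ha : QKD.aTilde N gph εK < √(N : ℝ) / 2) :
    P.prob ρ {o | QKD.VEP.Mph o > QKD.MphU P η MWU εK ε gQ gW gph o} ≤ 3 * εK + εB := by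
  open QKD in
  have hw := P.outcomeProb_nonneg ρ
  have hw1 := P.sum_outcomeProb ρ
  set w := P.outcomeProb ρ with hwdef
  have hprob : ∀ E, P.prob ρ E = weight w E := fun E => rfl
  rw [hprob] at hB ⊢
  have hεB : 0 ≤ εB := (weight_nonneg hw _).trans hB
  -- For εK ≥ 1 the claim is trivial; otherwise every ε is below 1, as Kato's inequality needs.
  rcases le_or_gt 1 εK with h1 | h1
  · have := weight_le_sum hw {o | VEP.Mph o > MphU P η MWU εK ε gQ gW gph o}
    linarith
  have hε1 : ∀ l, ε l < 1 := fun l => lt_of_le_of_lt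
    (hsum ▸ Finset.single_le_sum (fun l _ => (hε l).le) (Finset.mem_univ l)) h1
  have hN' : (0 : ℝ) < N := Nat.cast_pos.2 hN
  have hs : √(N : ℝ) ^ 2 = N := Real.sq_sqrt hN'.le
  have hs0 : 0 < √(N : ℝ) := Real.sqrt_pos.2 hN'
  -- the exceptional events
  let EQ : Fin nQ → Set (Fin N → Outcome nA nM) := fun l =>
    {o | η l * KSign (η l) (ε l) N (minVal (P.chiQ l)) (maxVal (P.chiQ l)) (gQ l) (P.MQ l o) <
      η l * condSum (P.chiQ l) N w o}
  let EW : Set (Fin N → Outcome nA nM) :=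
    {o | KPlusMono εK N (minVal P.chiW) (maxVal P.chiW) gW (P.MW o) < condSum P.chiW N w o}
  let Eph : Set (Fin N → Outcome nA nM) :=
    {o | condSum VEP.chiPh N w o < VEP.Mph o - scaledDeviation N (aTilde N gph εK)
      (bL N (aTilde N gph εK) εK) 0 1 (VEP.Mph o)}
  -- A negative η reverses the inequality, so the lower Kato bound is used there; for η = 0 the
  -- event is empty.
  have hEQ : ∀ l, weight w (EQ l) ≤ ε l := fun l => by
    rcases le_or_gt 0 (η l) with h | h
    · refine (weight_mono hw fun o _ ho => ?_).trans
        (weight_add_scaledDeviation_lt_condSum_le (minVal_le (P.chiQ l)) (le_maxVal (P.chiQ l))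
          hN hw hw1 (hε l) (hε1 l) (aU N (gQ l) (ε l)))
      simp only [EQ, Set.mem_ofPred_eq, KSign, if_pos h] at ho
      exact lt_of_mul_lt_mul_left ho h
    · refine (weight_mono hw fun o _ ho => ?_).trans
        (weight_condSum_lt_sub_scaledDeviation_le (minVal_le (P.chiQ l)) (le_maxVal (P.chiQ l))
          hN hw hw1 (hε l) (hε1 l) (aL N (gQ l) (ε l)))
      simp only [EQ, Set.mem_ofPred_eq, KSign, if_neg h.not_ge] at ho
      exact (mul_lt_mul_left_of_neg h).1 ho
  -- Kato's inequality holds for every real parameter, so the clamp costs no probability.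
  have hEW : weight w EW ≤ εK :=
    weight_add_scaledDeviation_lt_condSum_le (minVal_le P.chiW) (le_maxVal P.chiW)
      hN hw hw1 hεK h1 (max (-√(N : ℝ) / 2) (aU N gW εK))
  have hEph : weight w Eph ≤ εK :=
    weight_condSum_lt_sub_scaledDeviation_le (χ := VEP.chiPh (nA := nA) (nM := nM))
      (fun x => by cases x <;> simp only [VEP.chiPh] <;> (try split_ifs) <;> norm_num)
      (fun x => by cases x <;> simp only [VEP.chiPh] <;> (try split_ifs) <;> norm_num)
      hN hw hw1 hεK h1 (aTilde N gph εK)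
  have hsub : ∀ o, VEP.Mph o > MphU P η MWU εK ε gQ gW gph o →
      o ∈ ((⋃ l, EQ l) ∪ EW ∪ Eph) ∪ {o | P.MW o > MWU} := by
    intro o ho
    by_contra hcon
    simp only [Set.mem_union, Set.mem_iUnion, not_or, not_exists] at hcon
    obtain ⟨⟨⟨c1, c2⟩, c3⟩, c4⟩ := hcon
    simp only [EQ, EW, Eph, Set.mem_ofPred_eq, not_lt, gt_iff_lt] at c1 c2 c3 c4
    have hx : minVal P.chiW ≤ maxVal P.chiW :=
      (minVal_le P.chiW (.lwm 0)).trans (le_maxVal P.chiW (.lwm 0))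
    have c5 := c2.trans (KPlusMono_mono hN' εK gW hx c4)
    have hmain := P.condSum_chiPh_le ρ η hop o
    have hα : 0 ≤ (1 - P.α) / P.α := div_nonneg (sub_nonneg.2 P.α_le_one) P.α_pos.le
    have hC := hmain.trans (add_le_add (Finset.sum_le_sum fun l _ => c1 l)
      (mul_le_mul_of_nonneg_left c5 hα))
    refine absurd ho (not_lt.2 ?_)
    have hb : bTilde N gph εK = bL N (aTilde N gph εK) εK := rfl
    rw [MphU, hb]
    -- The lower Kato bound is affine in M_ph with slope 1 - 2ã/√N; this positivity is what allows
    -- solving for M_ph.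
    have hden : 0 < √(N : ℝ) - 2 * aTilde N gph εK := by linarith
    rw [div_mul_eq_mul_div, le_div_iff₀ hden]
    simp only [scaledDeviation, deviation, QKD.normalize] at c3
    set C := ∑ l, η l * KSign (η l) (ε l) N (minVal (P.chiQ l)) (maxVal (P.chiQ l)) (gQ l)
      (P.MQ l o) + (1 - P.α) / P.α * KPlusMono εK N (minVal P.chiW) (maxVal P.chiW) gW MWU
    set a := aTilde N gph εK
    set b := bL N a εK
    have c6 := mul_le_mul_of_nonneg_left (c3.trans hC) hs0.le
    have e1 : √(N : ℝ) * (VEP.Mph o - (1 - 0) * ((b + a * (2 * ((VEP.Mph o - N * 0) / (1 - 0)) / N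
        - 1)) * √(N : ℝ))) = VEP.Mph o * (√(N : ℝ) - 2 * a) - N * (b - a) := by
      field_simp
      ring_nf
      rw [hs]
      field_simp
    have e2 : (N : ℝ) * (1 / √(N : ℝ) * C + b - a) = √(N : ℝ) * C + N * (b - a) := by
      field_simp
      linear_combination -C * hs
    rw [e1] at c6
    rw [e2]
    linarith
  calc weight w {o | VEP.Mph o > MphU P η MWU εK ε gQ gW gph o}
      ≤ weight w (((⋃ l, EQ l) ∪ EW ∪ Eph) ∪ {o | P.MW o > MWU}) :=
        weight_mono hw fun o _ ho => hsub o ho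
    _ ≤ ((∑ l, ε l + εK) + εK) + εB := by
        refine (weight_union_le hw _ _).trans (add_le_add ?_ hB)
        refine (weight_union_le hw _ _).trans (add_le_add ?_ hEph)
        refine (weight_union_le hw _ _).trans (add_le_add ?_ hEW)
        exact (weight_iUnion_le hw _).trans (Finset.sum_le_sum fun l _ => hEQ l)
    _ = 3 * εK + εB := by rw [hsum]; ring
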